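/- Let $m,n,p$ be positive integers with $p\le\min\{m,n\}$, let $\mathcal M_p=\{X\in\mathbb R^{m\times n}:\operatorname{rank}X=p\}$ (an embedded submanifold of $\mathbb R^{m\times n}$), let $f:\mathcal M_p\to\mathbb R$ be smooth, and let $\|\cdot\|$ be the Frobenius norm. A point $X_*\in\mathcal M_p$ is a nondegenerate critical point of $f$ if $\operatorname{grad}f(X_*)=0$ and the Hessian $\mathrm T_{X_*}\mathcal M_p\ni\xi\mapsto\nabla_\xi\operatorname{grad}f\in\mathrm T_{X_*}\mathcal M_p$ is invertible, where $\operatorname{grad}$ and $\nabla$ are the gradient and the Levi-Civita connection of a Riemannian metric on $\mathcal M_p$; this notion does not depend on the metric, and the result below holds whichever Riemannian metric is used in it. Write $\pi(M,N)=MN^{\mathsf T}$, $\bar f=f\circ\pi$, $\operatorname{sym}(Z)=\frac12(Z+Z^{\mathsf T})$, let $\partial_M\bar f,\partial_N\bar f$ be the Euclidean partial gradients of $\bar f$, and let $\partial_u Y$ be the Euclidean derivative of a field $Y=(Y_M,Y_N)$ along $u=(u_M,u_N)$. Let $\mathbb R_*^{a\times p}$ be the set of full-rank $a\times p$ matrices.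 Consider two Newton iterations on $\mathcal M_p$. (A) On $T=\mathbb R_*^{m\times p}\times\mathbb R_*^{n\times p}$ take the metric $\bar g_{(M,N)}(u,v)=\operatorname{tr}\big((M^{\mathsf T}M)^{-1}u_M^{\mathsf T}v_M+(N^{\mathsf T}N)^{-1}u_N^{\mathsf T}v_N\big)$, the vertical space $\mathcal V_{(M,N)}=\{(MR,-NR^{\mathsf T}):R\in\mathbb R^{p\times p}\}$, its $\bar g$-orthogonal complement $\mathcal H_{(M,N)}$, the gradient $\operatorname{grad}\bar f=(\partial_M\bar f\,M^{\mathsf T}M,\ \partial_N\bar f\,N^{\mathsf T}N)$, the Riemannian connection $\bar\nabla$ of $\bar g$, $$(\bar\nabla_uY)_M=\partial_uY_M-Y_M(M^{\mathsf T}M)^{-1}\operatorname{sym}(u_M^{\mathsf T}M)-u_M(M^{\mathsf T}M)^{-1}\operatorname{sym}(Y_M^{\mathsf T}M)+M(M^{\mathsf T}M)^{-1}\operatorname{sym}(u_M^{\mathsf T}Y_M)$$ and likewise for the $N$-component, and the update $\rho_{(M,N)}(u)=(M+u_M)(N+u_N)^{\mathsf T}$. (B) On $T=\{M\in\mathbb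 R^{m\times p}:M^{\mathsf T}M=I_p\}\times\mathbb R_*^{n\times p}$ take the Euclidean metric, the tangent space $\mathrm T_{(M,N)}T=\{u:M^{\mathsf T}u_M+u_M^{\mathsf T}M=0\}$, the vertical space $\mathcal V_{(M,N)}=\{(M\Omega,N\Omega):\Omega=-\Omega^{\mathsf T}\}$, its orthogonal complement $\mathcal H_{(M,N)}$ in $\mathrm T_{(M,N)}T$, the orthogonal projection $P_{(M,N)}(w_M,w_N)=(w_M-M\operatorname{sym}(M^{\mathsf T}w_M),w_N)$ onto the tangent space, $\operatorname{grad}\bar f=P(\partial_M\bar f,\partial_N\bar f)$, $\bar\nabla_uY=P\,\partial_uY$, and the update $\rho_{(M,N)}(u)=\pi(\operatorname{Exp}_{(M,N)}(u))$, where, with $A=M^{\mathsf T}u_M$ and $S=u_M^{\mathsf T}u_M$, $$\operatorname{Exp}_{(M,N)}(u)=\Big(\begin{bmatrix}M&u_M\end{bmatrix}\exp\begin{bmatrix}A&-S\\ I&A\end{bmatrix}\begin{bmatrix}I_p\\0\end{bmatrix}\exp(-A),\ N+u_N\Big).$$ In both cases let $P^{\mathrm h}_{(M,N)}$ be the projection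 onto $\mathcal H_{(M,N)}$ along $\mathcal V_{(M,N)}$. The iteration maps $X=MN^{\mathsf T}$, $(M,N)\in T$, to $\rho_{(M,N)}(u)$, where $u\in\mathcal H_{(M,N)}$ is the solution of the Newton equation $$P^{\mathrm h}_{(M,N)}\big(\bar\nabla_u\operatorname{grad}\bar f\big)=-\operatorname{grad}\bar f(M,N).$$ It is well defined at $X$ if this solution exists and is unique for every factorization $X=MN^{\mathsf T}$ with $(M,N)\in T$, and the result lies in $\mathcal M_p$ and does not depend on the factorization. Theorem (quadratic convergence). Let $X_*$ be a nondegenerate critical point of $f$. For each of the iterations (A) and (B) there are a neighborhood $\mathcal U$ of $X_*$ in $\mathcal M_p$ and a constant $C$ such that, for every $X_0\in\mathcal U$, the iteration is well defined at every step and generates an infinite sequence $(X_k)_{k\ge0}$ in $\mathcal M_p$ that converges to $X_*$ superlinearly, $\|X_{k+1}-X_*\|=o(\|X_k-X_*\|)$, and at least quadratically, $\|X_{k+1}-X_*\|\le C\|X_k-X_*\|^2$ for all $k\ge0$. -/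

import Mathlib

open Filter Topology Asymptotics
open scoped Matrix ContDiff

attribute [local instance] Matrix.frobeniusNormedAddCommGroup Matrix.frobeniusNormedSpace

noncomputable section

namespace FixedRank

/-- Real `a × b` matrices. They carry the Frobenius norm throughout. -/
abbrev Mat (a b : ℕ) := Matrix (Fin a) (Fin b) ℝ

/-- The linear space of pairs `(M, N)`. -/
abbrev Pair (m n p : ℕ) := Mat m p × Mat n p

/-- The set of rank-`p` matrices of size `m × n`. -/
def Mp (m n p : ℕ) : Set (Mat m n) := {X | X.rank = p}

/-- The pairs `(M, N)` of full-rank factors. -/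
def Rp (m n p : ℕ) : Set (Pair m n p) := {z | z.1.rank = p ∧ z.2.rank = p}

/-- The pairs `(M, N)` with `M` orthonormal and `N` of full rank. -/
def SRp (m n p : ℕ) : Set (Pair m n p) := {z | z.1ᵀ * z.1 = 1 ∧ z.2.rank = p}

variable {m n p : ℕ}

/-- The map `(M, N) ↦ M Nᵀ`. -/
def proj (z : Pair m n p) : Mat m n := z.1 * z.2ᵀ

/-- Symmetric part of a square matrix. -/
def symPart (Z : Mat p p) : Mat p p := (1 / 2 : ℝ) • (Z + Zᵀ)

/-! ### Differential geometry of the submanifold of rank-`p` matrices -/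

/-- `φ` is smooth as a map on the embedded submanifold `Mp m n p`: locally it is the restriction
of a smooth map defined on an open subset of the ambient space. Values of `φ` outside the
submanifold are irrelevant. -/
def SmoothOnMp {F : Type*} [NormedAddCommGroup F] [NormedSpace ℝ F] (p : ℕ)
    (φ : Mat m n → F) : Prop :=
  ∀ X ∈ Mp m n p, ∃ V : Set (Mat m n), IsOpen V ∧ X ∈ V ∧
    ∃ Φ : Mat m n → F, ContDiffOn ℝ ∞ Φ V ∧ ∀ Y ∈ V ∩ Mp m n p, Φ Y = φ Y

/-- The differential at `X` of a map on the submanifold `Mp m n p`. Only its values on vectors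
tangent at `X ∈ Mp m n p` are meaningful (and these are uniquely determined). -/
def diffMp {F : Type*} [NormedAddCommGroup F] [NormedSpace ℝ F] (p : ℕ)
    (φ : Mat m n → F) (X : Mat m n) : Mat m n →L[ℝ] F :=
  fderivWithin ℝ φ (Mp m n p) X

/-- The tangent space of `Mp m n p` at `X ∈ Mp m n p`, i.e. the set of all `A X + X B`. By
`mem_tangentSpace_proj` below it is the image of the differential of the submersion `(M, N) ↦ M Nᵀ`
at any point of the fibre over `X`. -/
def tangentSpace (X : Mat m n) : Submodule ℝ (Mat m n) where
  carrier := {ξ | ∃ (A : Mat m m) (B : Mat n n), ξ = A * X + X * B}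
  zero_mem' := ⟨0, 0, by simp⟩
  add_mem' := by
    rintro _ _ ⟨A, B, rfl⟩ ⟨A', B', rfl⟩
    exact ⟨A + A', B + B', by rw [Matrix.add_mul, Matrix.mul_add]; abel⟩
  smul_mem' := by
    rintro c _ ⟨A, B, rfl⟩
    exact ⟨c • A, c • B, by simp⟩

theorem isUnit_gram {a b : ℕ} {M : Mat a b} (h : M.rank = b) : IsUnit (Mᵀ * M).det := by
  rw [← Matrix.isUnit_iff_isUnit_det, ← Matrix.mulVec_injective_iff_isUnit]
  have hr : (Mᵀ * M).rank = b := by rw [Matrix.rank_transpose_mul_self, h]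
  have hk := (Mᵀ * M).mulVecLin.finrank_range_add_finrank_ker
  rw [Matrix.rank] at hr
  have h0 : Module.finrank ℝ (LinearMap.ker (Mᵀ * M).mulVecLin) = 0 := by
    rw [hr] at hk; simpa using hk
  exact LinearMap.ker_eq_bot.1 (Submodule.finrank_eq_zero.1 h0)

theorem mem_tangentSpace_proj {z : Pair m n p} (hz : z ∈ Rp m n p) (ξ : Mat m n) :
    ξ ∈ tangentSpace (proj z) ↔ ∃ w : Pair m n p, ξ = w.1 * z.2ᵀ + z.1 * w.2ᵀ := by
  constructor
  · rintro ⟨A, B, rfl⟩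
    exact ⟨(A * z.1, Bᵀ * z.2), by simp [proj, Matrix.mul_assoc, Matrix.transpose_mul]⟩
  · rintro ⟨w, rfl⟩
    refine ⟨w.1 * (z.1ᵀ * z.1)⁻¹ * z.1ᵀ, z.2 * (z.2ᵀ * z.2)⁻¹ * w.2ᵀ, ?_⟩
    have h1 := Matrix.nonsing_inv_mul _ (isUnit_gram hz.1)
    have h2 := Matrix.mul_nonsing_inv _ (isUnit_gram hz.2)
    have e1 : w.1 * (z.1ᵀ * z.1)⁻¹ * z.1ᵀ * proj z
        = w.1 * ((z.1ᵀ * z.1)⁻¹ * (z.1ᵀ * z.1)) * z.2ᵀ := by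
      simp only [proj, Matrix.mul_assoc]
    have e2 : proj z * (z.2 * (z.2ᵀ * z.2)⁻¹ * w.2ᵀ)
        = z.1 * ((z.2ᵀ * z.2) * (z.2ᵀ * z.2)⁻¹) * w.2ᵀ := by
      simp only [proj, Matrix.mul_assoc]
    rw [e1, e2, h1, h2, Matrix.mul_one, Matrix.mul_one]

/-- Smooth vector fields on `Mp m n p`. -/
def IsVectorField (p : ℕ) (η : Mat m n → Mat m n) : Prop :=
  SmoothOnMp p η ∧ ∀ X ∈ Mp m n p, η X ∈ tangentSpace X

/-- `g` is a (smooth) Riemannian metric on `Mp m n p`. -/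
structure IsRiemannianMetric (p : ℕ) (g : Mat m n → Mat m n → Mat m n → ℝ) : Prop where
  add_left : ∀ X ∈ Mp m n p, ∀ ξ ∈ tangentSpace X, ∀ η ∈ tangentSpace X, ∀ ζ ∈ tangentSpace X,
    g X (ξ + η) ζ = g X ξ ζ + g X η ζ
  smul_left : ∀ X ∈ Mp m n p, ∀ c : ℝ, ∀ ξ ∈ tangentSpace X, ∀ ζ ∈ tangentSpace X,
    g X (c • ξ) ζ = c * g X ξ ζ
  symm : ∀ X ∈ Mp m n p, ∀ ξ ∈ tangentSpace X, ∀ ζ ∈ tangentSpace X, g X ξ ζ = g X ζ ξ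
  pos : ∀ X ∈ Mp m n p, ∀ ξ ∈ tangentSpace X, ξ ≠ 0 → 0 < g X ξ ξ
  smooth : ∀ η ζ, IsVectorField p η → IsVectorField p ζ → SmoothOnMp p fun X => g X (η X) (ζ X)

/-- `del χ η`, read `∇_χ η`, is the Riemannian (Levi-Civita) connection of the metric `g` on
`Mp m n p`: the affine connection that is torsion-free and compatible with the metric. -/
structure IsLeviCivita (p : ℕ) (g : Mat m n → Mat m n → Mat m n → ℝ)
    (del : (Mat m n → Mat m n) → (Mat m n → Mat m n) → Mat m n → Mat m n) : Prop where
  isVectorField : ∀ χ η, IsVectorField p χ → IsVectorField p η → IsVectorField p (del χ η)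
  add_left : ∀ χ χ' η, IsVectorField p χ → IsVectorField p χ' → IsVectorField p η →
    ∀ X ∈ Mp m n p, del (fun Y => χ Y + χ' Y) η X = del χ η X + del χ' η X
  smul_left : ∀ (φ : Mat m n → ℝ) χ η, SmoothOnMp p φ → IsVectorField p χ → IsVectorField p η →
    ∀ X ∈ Mp m n p, del (fun Y => φ Y • χ Y) η X = φ X • del χ η X
  add_right : ∀ χ η η', IsVectorField p χ → IsVectorField p η → IsVectorField p η' →
    ∀ X ∈ Mp m n p, del χ (fun Y => η Y + η' Y) X = del χ η X + del χ η' X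
  leibniz : ∀ (φ : Mat m n → ℝ) χ η, SmoothOnMp p φ → IsVectorField p χ → IsVectorField p η →
    ∀ X ∈ Mp m n p,
      del χ (fun Y => φ Y • η Y) X = diffMp p φ X (χ X) • η X + φ X • del χ η X
  torsion_free : ∀ χ η, IsVectorField p χ → IsVectorField p η → ∀ X ∈ Mp m n p,
    del χ η X - del η χ X = VectorField.lieBracketWithin ℝ χ η (Mp m n p) X
  metric_compatible : ∀ χ η ζ, IsVectorField p χ → IsVectorField p η → IsVectorField p ζ →
    ∀ X ∈ Mp m n p, diffMp p (fun Y => g Y (η Y) (ζ Y)) X (χ X)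
      = g X (del χ η X) (ζ X) + g X (η X) (del χ ζ X)

/-- `G` is the Riemannian gradient field of `f` on `Mp m n p` for the metric `g`. -/
def IsGradient (p : ℕ) (g : Mat m n → Mat m n → Mat m n → ℝ) (f : Mat m n → ℝ)
    (G : Mat m n → Mat m n) : Prop :=
  IsVectorField p G ∧
    ∀ X ∈ Mp m n p, ∀ ξ ∈ tangentSpace X, g X (G X) ξ = diffMp p f X ξ

/-- `X` is a nondegenerate critical point of `f` on `Mp m n p`: the gradient vanishes at `X`, and
the Hessian `ξ ↦ ∇_ξ grad f` is an invertible linear map of the tangent space at `X`; here `grad`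
and `∇` are the gradient and the Levi-Civita connection of the metric `g`. -/
def IsNondegenerateCriticalPoint (p : ℕ) (g : Mat m n → Mat m n → Mat m n → ℝ)
    (f : Mat m n → ℝ) (X : Mat m n) : Prop :=
  X ∈ Mp m n p ∧ ∃ G del, IsGradient p g f G ∧ IsLeviCivita p g del ∧ G X = 0 ∧
    ∃ hess : tangentSpace X ≃ₗ[ℝ] tangentSpace X,
      ∀ (ξ : tangentSpace X) (χ : Mat m n → Mat m n), IsVectorField p χ → χ X = ξ →
        del χ G X = hess ξ

/-! ### The lifted Newton iterations -/

/-- The function `f` lifted to pairs of factors, `(M, N) ↦ f (M Nᵀ)`. -/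
def lifted (f : Mat m n → ℝ) (z : Pair m n p) : ℝ := f (proj z)

/-- Euclidean gradient of a function of `(M, N)` with respect to `M`. -/
def partialM (F : Pair m n p → ℝ) (z : Pair m n p) : Mat m p :=
  Matrix.of fun i j => fderiv ℝ F z (Matrix.single i j 1, 0)

/-- Euclidean gradient of a function of `(M, N)` with respect to `N`. -/
def partialN (F : Pair m n p → ℝ) (z : Pair m n p) : Mat n p :=
  Matrix.of fun i j => fderiv ℝ F z (0, Matrix.single i j 1)

/-- `h` is the projection of `w` onto the horizontal space `H` along the vertical space `V`. -/
def IsHorizontalProj (H V : Set (Pair m n p)) (w h : Pair m n p) : Prop := h ∈ H ∧ w - h ∈ V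

/-- `u` is a solution in the horizontal space of the lifted Newton equation
`P^h (∇_u Y) = - Y(z)` at `z`, where `Y` is the gradient field on the total space and `conn Y z u`
is `∇_u Y` at `z`. -/
def IsNewtonVector (H V : Pair m n p → Set (Pair m n p))
    (conn : (Pair m n p → Pair m n p) → Pair m n p → Pair m n p → Pair m n p)
    (Y : Pair m n p → Pair m n p) (z u : Pair m n p) : Prop :=
  u ∈ H z ∧ IsHorizontalProj (H z) (V z) (conn Y z u) (-Y z)

/-- `X' ∈ Mp m n p` is the iterate that follows `X`: over `X` there are factorizations in the total
space `T`, and for each of them, `z`, the Newton equation has exactly one solution `u`, whose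
retraction at `z` is `X'`. -/
def IsStep (T : Set (Pair m n p)) (newton : Pair m n p → Pair m n p → Prop)
    (retr : Pair m n p → Pair m n p → Mat m n) (X X' : Mat m n) : Prop :=
  (∃ z ∈ T, proj z = X) ∧ X' ∈ Mp m n p ∧
    ∀ z ∈ T, proj z = X →
      ∃ u, newton z u ∧ (∀ u', newton z u' → u' = u) ∧ retr z u = X'

/-! #### Full-rank factors -/

/-- The metric `tr ((MᵀM)⁻¹ Ṁᵀ M' + (NᵀN)⁻¹ Ṅᵀ N')` on the total space `Rp m n p`. -/
def metric (z u v : Pair m n p) : ℝ :=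
  ((z.1ᵀ * z.1)⁻¹ * u.1ᵀ * v.1 + (z.2ᵀ * z.2)⁻¹ * u.2ᵀ * v.2).trace

/-- The tangent space of the fibre through `z`. -/
def vertical (z : Pair m n p) : Set (Pair m n p) :=
  {v | ∃ R : Mat p p, v = (z.1 * R, -(z.2 * Rᵀ))}

/-- The orthogonal complement of the vertical space. -/
def horizontal (z : Pair m n p) : Set (Pair m n p) := {u | ∀ v ∈ vertical z, metric z u v = 0}

/-- One component (`M` or `N`) of the Riemannian connection of `metric`: `M` is the base point,
`x` the direction, `y` the value of the field and `dy` its Euclidean derivative along `x`. -/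
def connFactor {a : ℕ} (M x y dy : Mat a p) : Mat a p :=
  dy - y * (Mᵀ * M)⁻¹ * symPart (xᵀ * M) - x * (Mᵀ * M)⁻¹ * symPart (yᵀ * M)
    + M * (Mᵀ * M)⁻¹ * symPart (xᵀ * y)

/-- The Riemannian connection of `metric` on `Rp m n p`: `conn Y z u` is `∇_u Y` at `z`. -/
def conn (Y : Pair m n p → Pair m n p) (z u : Pair m n p) : Pair m n p :=
  (connFactor z.1 u.1 (Y z).1 (fderiv ℝ Y z u).1, connFactor z.2 u.2 (Y z).2 (fderiv ℝ Y z u).2)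

/-- The gradient, for `metric`, of the lifted function. -/
def gradLifted (f : Mat m n → ℝ) (z : Pair m n p) : Pair m n p :=
  (partialM (lifted f) z * (z.1ᵀ * z.1), partialN (lifted f) z * (z.2ᵀ * z.2))

/-- Newton iteration `M Nᵀ ↦ (M + Ṁ)(N + Ṅ)ᵀ`, where `(Ṁ, Ṅ)` solves the lifted Newton equation on
`Rp m n p`. -/
def NewtonStep (p : ℕ) (f : Mat m n → ℝ) : Mat m n → Mat m n → Prop :=
  IsStep (Rp m n p) (IsNewtonVector horizontal vertical conn (gradLifted f))
    fun z u => proj (z + u)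

/-! #### First factor orthonormal -/

/-- The tangent space of `SRp m n p` at `z`. -/
def oTangent (z : Pair m n p) : Set (Pair m n p) := {u | z.1ᵀ * u.1 + u.1ᵀ * z.1 = 0}

/-- The Euclidean metric. -/
def oMetric (u v : Pair m n p) : ℝ := (u.1ᵀ * v.1 + u.2ᵀ * v.2).trace

/-- The tangent space of the fibre through `z`. -/
def oVertical (z : Pair m n p) : Set (Pair m n p) :=
  {v | ∃ W : Mat p p, W = -Wᵀ ∧ v = (z.1 * W, z.2 * W)}

/-- The orthogonal complement of the vertical space in the tangent space. -/
def oHorizontal (z : Pair m n p) : Set (Pair m n p) :=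
  {u | u ∈ oTangent z ∧ ∀ v ∈ oVertical z, oMetric u v = 0}

/-- The orthogonal projection onto the tangent space of `SRp m n p` at `z`. -/
def oTangentProj (z w : Pair m n p) : Pair m n p := (w.1 - z.1 * symPart (z.1ᵀ * w.1), w.2)

/-- The Riemannian connection of the Riemannian submanifold `SRp m n p` of the Euclidean space of
pairs; the field `Y` is given on a neighbourhood of `SRp m n p`, on which the result does not
depend. -/
def oConn (Y : Pair m n p → Pair m n p) (z u : Pair m n p) : Pair m n p :=
  oTangentProj z (fderiv ℝ Y z u)

/-- The gradient on `SRp m n p` of the lifted function: the projection of its Euclidean gradient.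
(The formula makes sense on all of `Rp m n p`.) -/
def oGradLifted (f : Mat m n → ℝ) (z : Pair m n p) : Pair m n p :=
  oTangentProj z (partialM (lifted f) z, partialN (lifted f) z)

/-- The Riemannian exponential of `SRp m n p`; the block row `[M Ṁ]` is multiplied by the matrix
exponential of `[A -S; I A]`, by the first `p` columns of the identity of size `2p`, and by the
matrix exponential of `-A`, with `A = MᵀṀ` and `S = ṀᵀṀ`. -/
def oExp (z u : Pair m n p) : Pair m n p :=
  (Matrix.fromCols z.1 u.1
      * NormedSpace.exp
          (Matrix.fromBlocks (z.1ᵀ * u.1) (-(u.1ᵀ * u.1)) (1 : Mat p p) (z.1ᵀ * u.1))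
      * Matrix.fromRows (1 : Mat p p) (0 : Mat p p)
      * NormedSpace.exp (-(z.1ᵀ * u.1)),
    z.2 + u.2)

/-- Newton iteration `M Nᵀ ↦ π (Exp_{(M,N)} (Ṁ, Ṅ))`, where `(Ṁ, Ṅ)` solves the lifted Newton
equation on `SRp m n p`. -/
def NewtonStepOrtho (p : ℕ) (f : Mat m n → ℝ) : Mat m n → Mat m n → Prop :=
  IsStep (SRp m n p) (IsNewtonVector oHorizontal oVertical oConn (oGradLifted f))
    fun z u => proj (oExp z u)

/-! ### Local quadratic convergence -/

/-- From every point of some neighbourhood of `Xs` in `Mp m n p` the iteration `step` generates an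
infinite sequence in `Mp m n p` that converges to `Xs` superlinearly and at least quadratically. -/
def LocallyQuadraticallyConvergent (p : ℕ) (step : Mat m n → Mat m n → Prop) (Xs : Mat m n) :
    Prop :=
  ∃ U ⊆ Mp m n p, U ∈ 𝓝[Mp m n p] Xs ∧ ∃ C : ℝ, ∀ X₀ ∈ U, ∃ X : ℕ → Mat m n,
    X 0 = X₀ ∧ (∀ k, X k ∈ Mp m n p) ∧ (∀ k, step (X k) (X (k + 1))) ∧
    Tendsto X atTop (𝓝 Xs) ∧
    (fun k => X (k + 1) - Xs) =o[atTop] (fun k => X k - Xs) ∧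
    ∀ k, ‖X (k + 1) - Xs‖ ≤ C * ‖X k - Xs‖ ^ 2

end FixedRank

end

/-! ### Calculus behind a Newton step: smooth linear systems and second-order contact. -/

section Analysis

variable {E W F : Type*} [NormedAddCommGroup E] [NormedSpace ℝ E]
  [NormedAddCommGroup W] [NormedSpace ℝ W] [NormedAddCommGroup F] [NormedSpace ℝ F]

/-! The analysis takes place in the linear space of pairs `(M, N)`, without charts on `Mp`. The open
set `Rp` maps onto `Mp`, so `lifted f` is an ordinary smooth function there. Over a nondegenerate
critical point its first derivative vanishes, and its second derivative is `g (Hess (dπ u)) (dπ v)`,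
whose kernel is exactly `ker dπ`. The metric `g` and its connection enter only through this fact
(`IsNondegenerateCriticalPoint.lifted`).

The horizontal Newton equation is rewritten as a square linear system `A z (u, Q) = (-Y z, 0)`,
where `Y` is the lifted gradient and `Q` is a multiplier for the vertical part. The system depends
smoothly on `z` and is injective at the critical pair `z₀` (`newtonOp_injective`,
`oNewtonOp_injective`), so its solution `u(z)` is smooth and `u(z₀) = 0`. The correction terms of
the connection vanish where `Y = 0`. Differentiating the system therefore shows that `u'(z₀) e`
equals `-e` up to `ker dπ` (`newtonOp_key`, `oNewtonOp_key`). The derivative of `z ↦ ρ_z (u(z))` at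
`z₀` is `dπ (e + u'(z₀) e) = 0`, and a C² map with zero derivative stays quadratically close to its
value (`exists_newton_step_bound`).

Two facts bring this down to `Mp`. Each `X` near `X_*` has a factorization whose distance to `z₀` is
`O(‖X - X_*‖)` (`exists_local_section`). The fibres are orbits of the general linear group, or of
the orthogonal group for (B), and every ingredient of the iteration is equivariant, so the
factorization does not matter. -/

theorem ContDiffAt.isBigO_sq_of_fderiv_eq_zero {f : E → F} {z : E} (hf : ContDiffAt ℝ 2 f z)
    (h0 : fderiv ℝ f z = 0) :
    ∃ C, ∀ᶠ w in 𝓝 z, ‖f w - f z‖ ≤ C * ‖w - z‖ ^ 2 := by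
  have h1 : ContDiffAt ℝ 1 (fderiv ℝ f) z := hf.fderiv_right (by norm_num)
  obtain ⟨K, t, ht, hK⟩ := h1.exists_lipschitzOnWith
  have hd : ∀ᶠ w in 𝓝 z, DifferentiableAt ℝ f w :=
    (hf.eventually (by simp)).mono fun w hw => hw.differentiableAt (by norm_num)
  obtain ⟨r, hr, hball⟩ := Metric.eventually_nhds_iff_ball.1 (hd.and (eventually_mem_set.2 ht))
  have hzt : z ∈ t := mem_of_mem_nhds ht
  refine ⟨K, Metric.eventually_nhds_iff_ball.2 ⟨r, hr, fun w hw => ?_⟩⟩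
  have hsub : ∀ x ∈ Metric.closedBall z ‖w - z‖, x ∈ Metric.ball z r := fun x hx => by
    rw [Metric.mem_closedBall] at hx
    rw [Metric.mem_ball, dist_eq_norm] at hw
    exact lt_of_le_of_lt hx hw
  -- The derivative is Lipschitz and zero at `z`, hence at most `K * ‖w - z‖` on this ball; the mean
  -- value inequality supplies the second factor `‖w - z‖`.
  have := Convex.norm_image_sub_le_of_norm_fderiv_le (𝕜 := ℝ) (f := f) (C := K * ‖w - z‖)
    (s := Metric.closedBall z ‖w - z‖) (x := z) (y := w)
    (fun x hx => (hball x (hsub x hx)).1)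
    (fun x hx => by
      have := hK.dist_le_mul x (hball x (hsub x hx)).2 z hzt
      rw [h0, dist_zero_right] at this
      exact this.trans (mul_le_mul_of_nonneg_left hx K.2))
    (convex_closedBall _ _) (Metric.mem_closedBall_self (norm_nonneg _))
    (by rw [Metric.mem_closedBall, dist_eq_norm])
  rwa [mul_assoc, ← sq] at this

theorem ContDiffAt.fderiv_apply_const {f : E → F} {z : E} (hf : ContDiffAt ℝ ∞ f z) (u : E) :
    ContDiffAt ℝ ∞ (fun w => fderiv ℝ f w u) z :=
  (hf.fderiv_right (m := ∞) (by simp)).clm_apply contDiffAt_const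

/-- Coordinates on `W` turn an operator into the tuple of its values on a basis. Smoothness of the
Newton operators can then be checked with the argument vector fixed. -/
theorem contDiffAt_clm_of_apply {k : WithTop ℕ∞} [FiniteDimensional ℝ W] {f : E → W →L[ℝ] F}
    {z : E} (h : ∀ y, ContDiffAt ℝ k (fun x => f x y) z) : ContDiffAt ℝ k f z := by
  let d := Module.finrank ℝ W
  have hd : d = Module.finrank ℝ (Fin d → ℝ) := (Module.finrank_fin_fun ℝ).symm
  let e₁ := ContinuousLinearEquiv.ofFinrankEq hd
  let e₂ := (e₁.arrowCongr (1 : F ≃L[ℝ] F)).trans (ContinuousLinearEquiv.piRing (Fin d))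
  rw [← Function.id_comp f, ← e₂.symm_comp_self]
  exact e₂.symm.contDiff.contDiffAt.comp z (contDiffAt_pi.mpr fun i => h _)

/-- A linear system that depends smoothly on a parameter, is nonsingular at `z₀` and has zero
right-hand side there, has a unique small solution near `z₀`, which depends smoothly on the
parameter. -/
theorem exists_smooth_solution [FiniteDimensional ℝ W] {A : E → W →ₗ[ℝ] W} {b : E → W} {z₀ : E}
    (hA : ∀ x, ContDiffAt ℝ 2 (fun z => A z x) z₀) (hinj : Function.Injective (A z₀))
    (hb : ContDiffAt ℝ 2 b z₀) (hb0 : b z₀ = 0) :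
    ∃ x : E → W, ContDiffAt ℝ 2 x z₀ ∧ x z₀ = 0 ∧
      (∀ᶠ z in 𝓝 z₀, ∀ y, A z y = b z ↔ y = x z) ∧
      ∀ e, A z₀ (fderiv ℝ x z₀ e) = fderiv ℝ b z₀ e := by
  have : CompleteSpace W := FiniteDimensional.complete ℝ W
  let A' : E → W →L[ℝ] W := fun z => LinearMap.toContinuousLinearMap (A z)
  have hA' : ContDiffAt ℝ 2 A' z₀ := contDiffAt_clm_of_apply hA
  let e : W ≃L[ℝ] W := (LinearEquiv.ofInjectiveEndo (A z₀) hinj).toContinuousLinearEquiv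
  have he : (e : W →L[ℝ] W) = A' z₀ := rfl
  have hinv : ContDiffAt ℝ 2 (fun z => (A' z).inverse) z₀ := by
    have := contDiffAt_map_inverse (𝕜 := ℝ) (n := 2) e
    rw [he] at this
    exact this.comp z₀ hA'
  have hx : ContDiffAt ℝ 2 (fun z => (A' z).inverse (b z)) z₀ := hinv.clm_apply hb
  have hev : ∀ᶠ z in 𝓝 z₀, ∀ y, A z y = b z ↔ y = (A' z).inverse (b z) := by
    -- Invertible operators form an open set, so `A z` stays invertible for `z` near `z₀`.
    have h1 := e.nhds
    rw [he] at h1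
    filter_upwards [hA'.continuousAt.eventually h1] with z hz y
    obtain ⟨e', he'⟩ := hz
    have h2 : ∀ y, A z y = e' y := fun y => (DFunLike.congr_fun he' y).symm
    rw [← he', ContinuousLinearMap.inverse_equiv, h2]
    exact e'.eq_symm_apply.symm
  refine ⟨_, hx, by simp [hb0], hev, fun v => ?_⟩
  -- Differentiate `A z (x z) = b z` at `z₀`: the term containing the derivative of `A` carries the
  -- factor `x z₀ = 0`.
  have h3 : (fun z => A' z ((A' z).inverse (b z))) =ᶠ[𝓝 z₀] b := by
    filter_upwards [hev] with z hz
    exact (hz _).2 rfl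
  have h4 := (hA'.differentiableAt (by norm_num)).hasFDerivAt.clm_apply
    (hx.differentiableAt (by norm_num)).hasFDerivAt
  have h5 := (h4.congr_of_eventuallyEq h3.symm).fderiv
  rw [h5]
  simp [hb0]
  rfl

/-- Local analysis of a Newton step. -/
theorem exists_newton_step_bound {K : Type*} [NormedAddCommGroup K] [NormedSpace ℝ K]
    [FiniteDimensional ℝ E] [FiniteDimensional ℝ K] {z₀ : E} {T : Set E} {newton : E → E → Prop}
    {retr : E → E → F} {M : Set F} {Y : E → E} {A : E → (E × K) →ₗ[ℝ] (E × K)} {π : E →ₗ[ℝ] F}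
    (hA : ∀ x, ContDiffAt ℝ 2 (fun z => A z x) z₀)
    (hinj : ∀ x, A z₀ x = 0 → x = 0)
    (hY : ContDiffAt ℝ 2 Y z₀) (hY0 : Y z₀ = 0)
    (hnewton : ∀ᶠ z in 𝓝 z₀, z ∈ T → ∀ u, newton z u ↔ ∃ Q, A z (u, Q) = (-Y z, 0))
    (hretr : ContDiffAt ℝ 2 (fun q : E × E => retr q.1 q.2) (z₀, 0))
    (hretr' : ∀ a b, fderiv ℝ (fun q : E × E => retr q.1 q.2) (z₀, 0) (a, b) = π (a + b))
    (hM : ∀ᶠ q : E × E in 𝓝 (z₀, 0), retr q.1 q.2 ∈ M)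
    (hkey : ∀ e x, A z₀ x = (fderiv ℝ Y z₀ e, 0) → π x.1 = π e) :
    ∃ C, ∀ᶠ z in 𝓝 z₀, z ∈ T → ∃ u, newton z u ∧ (∀ u', newton z u' → u' = u) ∧
      retr z u ∈ M ∧ ‖retr z u - retr z₀ 0‖ ≤ C * ‖z - z₀‖ ^ 2 := by
  -- The system is solved for all `z` near `z₀`; membership in `T` only serves to identify it with
  -- the Newton equation.
  have hb : ContDiffAt ℝ 2 (fun z => ((-Y z, 0) : E × K)) z₀ := hY.neg.prodMk contDiffAt_const
  obtain ⟨x, hx, hx0, hsol, hder⟩ := exists_smooth_solution hA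
    ((injective_iff_map_eq_zero _).2 hinj) hb (by simp [hY0])
  have hYd := (hY.differentiableAt (by norm_num)).hasFDerivAt
  have hxd := (hx.differentiableAt (by norm_num)).hasFDerivAt
  have hbd : fderiv ℝ (fun z => ((-Y z, 0) : E × K)) z₀ = (-(fderiv ℝ Y z₀)).prod 0 :=
    (hYd.neg.prodMk (hasFDerivAt_const (0 : K) z₀)).fderiv
  -- The right-hand side is `-Y`, so `hkey` is applied to `-e`: the solution moves by `-e` as seen
  -- through `π`.
  have hπ : ∀ e, π (e + (fderiv ℝ x z₀ e).1) = 0 := fun e => by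
    have := hkey (-e) (fderiv ℝ x z₀ e) (by rw [hder, hbd]; simp)
    rw [map_add, this, map_neg, add_neg_cancel]
  have hpair : ContDiffAt ℝ 2 (fun z => (z, (x z).1)) z₀ := contDiffAt_id.prodMk hx.fst
  have hp0 : (fun z => (z, (x z).1)) z₀ = (z₀, 0) := by simp [hx0]
  have hΨ : ContDiffAt ℝ 2 (fun z => retr z (x z).1) z₀ := by
    rw [← hp0] at hretr
    exact ContDiffAt.comp z₀ hretr hpair
  have hΨ' : fderiv ℝ (fun z => retr z (x z).1) z₀ = 0 := by
    have h1 := (hretr.differentiableAt (by norm_num)).hasFDerivAt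
    rw [← hp0] at h1
    have h2 := (h1.comp z₀ ((hasFDerivAt_id z₀).prodMk hxd.fst)).fderiv
    ext e
    refine (DFunLike.congr_fun h2 e).trans ?_
    rw [hp0, ContinuousLinearMap.comp_apply, ContinuousLinearMap.prod_apply, hretr']
    exact hπ e
  obtain ⟨C, hC⟩ := hΨ.isBigO_sq_of_fderiv_eq_zero hΨ'
  refine ⟨C, ?_⟩
  have hMx : ∀ᶠ z in 𝓝 z₀, retr z (x z).1 ∈ M := by
    rw [← hp0] at hM
    exact hpair.continuousAt.eventually hM
  filter_upwards [hC, hMx, hsol, hnewton] with z h1 h2 h3 h4 hzT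
  refine ⟨(x z).1, ?_, fun u' hu' => ?_, h2, ?_⟩
  · exact (h4 hzT _).2 ⟨(x z).2, (h3 _).2 rfl⟩
  · obtain ⟨Q, hQ⟩ := (h4 hzT _).1 hu'
    rw [← (h3 _).1 hQ]
  · simpa [hx0] using h1

end Analysis

/-! ### From a quadratic one-step bound to convergence. -/

namespace FixedRank
variable {m n p : ℕ}

theorem locallyQuadraticallyConvergent_of_bound {step : Mat m n → Mat m n → Prop} {Xs : Mat m n}
    {C : ℝ} (h : ∀ᶠ X in 𝓝 Xs, X ∈ Mp m n p → ∃ X' ∈ Mp m n p, step X X' ∧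
      ‖X' - Xs‖ ≤ C * ‖X - Xs‖ ^ 2) : LocallyQuadraticallyConvergent p step Xs := by
  obtain ⟨r, hr, hball⟩ := Metric.eventually_nhds_iff_ball.1 h
  -- `D` is a positive substitute for `C`. Within radius `1 / (2 * D)` one has `D * ‖X - Xs‖ ≤ 1 /
  -- 2`, so a step halves the error and cannot leave `U`.
  set D := |C| + 1 with hD
  have hD0 : 0 < D := by positivity
  set ρ := min r (1 / (2 * D)) with hρ
  have hρ0 : 0 < ρ := by positivity
  let U : Set (Mat m n) := {X | X ∈ Mp m n p ∧ ‖X - Xs‖ < ρ}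
  have hstep : ∀ X ∈ U, ∃ X' ∈ U, step X X' ∧ ‖X' - Xs‖ ≤ D * ‖X - Xs‖ ^ 2 ∧
      ‖X' - Xs‖ ≤ 1 / 2 * ‖X - Xs‖ := by
    rintro X ⟨hX, hXr⟩
    obtain ⟨X', hX', hs, hb⟩ := hball X (by
      rw [Metric.mem_ball, dist_eq_norm]; exact hXr.trans_le (min_le_left _ _)) hX
    have hb1 : ‖X' - Xs‖ ≤ D * ‖X - Xs‖ ^ 2 := hb.trans (by
      have := le_abs_self C
      gcongr; linarith)
    have hb2 : D * ‖X - Xs‖ ≤ 1 / 2 := by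
      have : ‖X - Xs‖ ≤ 1 / (2 * D) := hXr.le.trans (min_le_right _ _)
      calc D * ‖X - Xs‖ ≤ D * (1 / (2 * D)) := by gcongr
        _ = 1 / 2 := by field_simp
    have hb3 : ‖X' - Xs‖ ≤ 1 / 2 * ‖X - Xs‖ := hb1.trans (by
      rw [sq, ← mul_assoc]; gcongr)
    refine ⟨X', ⟨hX', ?_⟩, hs, hb1, hb3⟩
    linarith [norm_nonneg (X - Xs)]
  choose! next hU hs hq hl using hstep
  refine ⟨U, fun X hX => hX.1, ?_, D, fun X₀ hX₀ => ⟨fun k => next^[k] X₀, rfl, ?_⟩⟩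
  · rw [mem_nhdsWithin_iff_exists_mem_nhds_inter]
    refine ⟨Metric.ball Xs ρ, Metric.ball_mem_nhds _ hρ0, fun X hX => ⟨hX.2, ?_⟩⟩
    rw [← dist_eq_norm]; exact hX.1
  have hmem : ∀ k, next^[k] X₀ ∈ U := fun k => by
    induction k with
    | zero => exact hX₀
    | succ k ih => rw [Function.iterate_succ_apply']; exact hU _ ih
  have hsucc : ∀ k, next^[k + 1] X₀ = next (next^[k] X₀) := fun k =>
    Function.iterate_succ_apply' _ _ _
  have hgeo : ∀ k, ‖next^[k] X₀ - Xs‖ ≤ (1 / 2) ^ k * ‖X₀ - Xs‖ := fun k => by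
    induction k with
    | zero => simp
    | succ k ih =>
      rw [hsucc]
      calc _ ≤ 1 / 2 * ‖next^[k] X₀ - Xs‖ := hl _ (hmem k)
        _ ≤ 1 / 2 * ((1 / 2) ^ k * ‖X₀ - Xs‖) := by gcongr
        _ = _ := by ring
  have hnorm : Tendsto (fun k => ‖next^[k] X₀ - Xs‖) atTop (𝓝 0) := by
    refine squeeze_zero (fun _ => norm_nonneg _) hgeo ?_
    simpa using (tendsto_pow_atTop_nhds_zero_of_lt_one (r := (1 / 2 : ℝ)) (by norm_num)
      (by norm_num)).mul_const ‖X₀ - Xs‖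
  have hquad : ∀ k, ‖next^[k + 1] X₀ - Xs‖ ≤ D * ‖next^[k] X₀ - Xs‖ ^ 2 := fun k => by
    rw [hsucc]; exact hq _ (hmem k)
  refine ⟨fun k => (hmem k).1, fun k => ?_, tendsto_iff_norm_sub_tendsto_zero.2 hnorm, ?_, hquad⟩
  · simp only [hsucc]; exact hs _ (hmem k)
  · rw [isLittleO_iff]
    intro c hc
    have h1 : Tendsto (fun k => D * ‖next^[k] X₀ - Xs‖) atTop (𝓝 0) := by
      simpa using hnorm.const_mul D
    filter_upwards [h1.eventually (gt_mem_nhds hc)] with k hk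
    refine (hquad k).trans ?_
    rw [sq, ← mul_assoc]
    gcongr

end FixedRank

/-! ### Smoothness of matrix operations in the Frobenius norm. -/

section MatrixCalculus

variable {E : Type*} [NormedAddCommGroup E] [NormedSpace ℝ E] {k : WithTop ℕ∞} {x : E}
  {a b c : Type*} [Fintype a] [Fintype b] [Fintype c]

theorem Matrix.isBoundedBilinearMap_mul :
    IsBoundedBilinearMap ℝ (fun q : Matrix a b ℝ × Matrix b c ℝ => q.1 * q.2) where
  add_left _ _ _ := by simp [Matrix.add_mul]
  smul_left _ _ _ := by simp
  add_right _ _ _ := by simp [Matrix.mul_add]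
  smul_right _ _ _ := by simp
  bound := ⟨1, one_pos, fun x y => by simpa using Matrix.frobenius_norm_mul x y⟩

@[fun_prop]
theorem ContDiffAt.matrix_mul {f : E → Matrix a b ℝ} {g : E → Matrix b c ℝ}
    (hf : ContDiffAt ℝ k f x) (hg : ContDiffAt ℝ k g x) :
    ContDiffAt ℝ k (fun y => f y * g y) x :=
  Matrix.isBoundedBilinearMap_mul.contDiff.contDiffAt.comp x (hf.prodMk hg)

theorem HasFDerivAt.matrix_mul {f : E → Matrix a b ℝ} {g : E → Matrix b c ℝ}
    {f' : E →L[ℝ] Matrix a b ℝ} {g' : E →L[ℝ] Matrix b c ℝ}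
    (hf : HasFDerivAt f f' x) (hg : HasFDerivAt g g' x) :
    ∃ h' : E →L[ℝ] Matrix a c ℝ, HasFDerivAt (fun y => f y * g y) h' x ∧
      ∀ v, h' v = f x * g' v + f' v * g x := by
  have h := (Matrix.isBoundedBilinearMap_mul.hasFDerivAt (f x, g x)).comp x (hf.prodMk hg)
  refine ⟨(Matrix.isBoundedBilinearMap_mul.deriv (f x, g x)).comp (f'.prod g'), ?_, fun v => ?_⟩
  · exact h
  · rfl

theorem HasDerivAt.matrix_mul {f : ℝ → Matrix a b ℝ} {g : ℝ → Matrix b c ℝ}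
    {f' : Matrix a b ℝ} {g' : Matrix b c ℝ} {t : ℝ}
    (hf : HasDerivAt f f' t) (hg : HasDerivAt g g' t) :
    HasDerivAt (fun y => f y * g y) (f t * g' + f' * g t) t := by
  obtain ⟨h', h1, h2⟩ := hf.hasFDerivAt.matrix_mul hg.hasFDerivAt
  have := h1.hasDerivAt
  rw [h2] at this
  simpa using this

theorem LinearMap.contDiffAt_comp {V W : Type*} [NormedAddCommGroup V] [NormedSpace ℝ V]
    [FiniteDimensional ℝ V] [NormedAddCommGroup W] [NormedSpace ℝ W] (L : V →ₗ[ℝ] W) {f : E → V}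
    (hf : ContDiffAt ℝ k f x) : ContDiffAt ℝ k (fun y => L (f y)) x :=
  (LinearMap.toContinuousLinearMap L).contDiff.contDiffAt.comp x hf

@[fun_prop]
theorem ContDiffAt.matrix_transpose {f : E → Matrix a b ℝ} (hf : ContDiffAt ℝ k f x) :
    ContDiffAt ℝ k (fun y => (f y)ᵀ) x :=
  (Matrix.transposeLinearEquiv a b ℝ ℝ).toLinearMap.contDiffAt_comp hf

attribute [local instance] Matrix.frobeniusNormedRing Matrix.frobeniusNormedAlgebra

theorem ContDiffAt.matrix_inv [DecidableEq a] {f : E → Matrix a a ℝ} (hf : ContDiffAt ℝ k f x)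
    (hx : IsUnit (f x).det) : ContDiffAt ℝ k (fun y => (f y)⁻¹) x := by
  have : CompleteSpace (Matrix a a ℝ) := FiniteDimensional.complete ℝ _
  obtain ⟨u, hu⟩ := (Matrix.isUnit_iff_isUnit_det _).2 hx
  have h := contDiffAt_ringInverse ℝ (n := k) u
  rw [hu] at h
  simp only [Matrix.nonsing_inv_eq_ringInverse]
  exact h.comp x hf

@[fun_prop]
theorem ContDiffAt.matrix_exp [DecidableEq a] {f : E → Matrix a a ℝ} (hf : ContDiffAt ℝ k f x) :
    ContDiffAt ℝ k (fun y => NormedSpace.exp (f y)) x := by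
  have : CompleteSpace (Matrix a a ℝ) := FiniteDimensional.complete ℝ _
  have h : AnalyticAt ℝ (NormedSpace.exp : Matrix a a ℝ → Matrix a a ℝ) (f x) :=
    NormedSpace.exp_analytic (𝕂 := ℝ) _
  exact h.contDiffAt.comp x hf

theorem Matrix.hasDerivAt_exp_smul_zero [DecidableEq a] (B : Matrix a a ℝ) :
    HasDerivAt (fun t : ℝ => NormedSpace.exp (t • B)) B 0 := by
  have : CompleteSpace (Matrix a a ℝ) := FiniteDimensional.complete ℝ _
  have h := hasDerivAt_exp_smul_const (𝕂 := ℝ) B (0 : ℝ)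
  simp only [zero_smul, NormedSpace.exp_zero, one_mul] at h
  exact h

end MatrixCalculus

/-! ### Full-rank factors and the action of the general linear group. -/

namespace FixedRank
variable {m n p : ℕ}

@[fun_prop]
theorem contDiffAt_symPart {E : Type*} [NormedAddCommGroup E] [NormedSpace ℝ E] {k : WithTop ℕ∞}
    {x : E} {f : E → Mat p p} (hf : ContDiffAt ℝ k f x) :
    ContDiffAt ℝ k (fun y => symPart (f y)) x := by
  unfold symPart
  fun_prop

/-- Full column rank becomes the nonvanishing of a continuous function. Hence `Rp` is open, and
derivatives of lifted maps are ordinary ones. -/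
theorem rank_eq_iff_isUnit_gram {a b : ℕ} {M : Mat a b} : M.rank = b ↔ IsUnit (Mᵀ * M).det := by
  refine ⟨isUnit_gram, fun h => ?_⟩
  rw [← Matrix.rank_transpose_mul_self, Matrix.rank_of_isUnit _
    ((Matrix.isUnit_iff_isUnit_det _).2 h), Fintype.card_fin]

theorem isOpen_rank_eq (a b : ℕ) : IsOpen {M : Mat a b | M.rank = b} := by
  simp only [rank_eq_iff_isUnit_gram, isUnit_iff_ne_zero]
  exact isOpen_ne.preimage (by fun_prop)

theorem isOpen_Rp : IsOpen (Rp m n p) :=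
  ((isOpen_rank_eq m p).preimage continuous_fst).inter ((isOpen_rank_eq n p).preimage continuous_snd)

/-- The product `Mᵀ (M Nᵀ) N` consists of two invertible Gram matrices, so the rank of `M Nᵀ` cannot
fall below `p`. -/
theorem proj_mem {z : Pair m n p} (hz : z ∈ Rp m n p) : proj z ∈ Mp m n p := by
  refine le_antisymm ?_ ?_
  · exact (Matrix.rank_mul_le_left _ _).trans hz.1.le
  · have h1 : (z.1ᵀ * proj z * z.2).rank = p := by
      have e : z.1ᵀ * proj z * z.2 = (z.1ᵀ * z.1) * (z.2ᵀ * z.2) := by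
        simp only [proj, Matrix.mul_assoc]
      rw [e, Matrix.rank_of_isUnit, Fintype.card_fin]
      rw [Matrix.isUnit_iff_isUnit_det, Matrix.det_mul]
      exact (isUnit_gram hz.1).mul (isUnit_gram hz.2)
    calc p = (z.1ᵀ * proj z * z.2).rank := h1.symm
      _ ≤ (z.1ᵀ * proj z).rank := Matrix.rank_mul_le_left _ _
      _ ≤ _ := Matrix.rank_mul_le_right _ _

theorem SRp_subset_Rp : SRp m n p ⊆ Rp m n p := fun z hz =>
  ⟨rank_eq_iff_isUnit_gram.2 (by rw [hz.1]; simp), hz.2⟩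

/-- The action of the general linear group on pairs of factors. -/
noncomputable def act (R : Mat p p) : Pair m n p →ₗ[ℝ] Pair m n p where
  toFun z := (z.1 * R, z.2 * R⁻¹ᵀ)
  map_add' _ _ := by simp [Matrix.add_mul]
  map_smul' _ _ := by simp

@[simp] theorem act_fst (R : Mat p p) (z : Pair m n p) : (act R z).1 = z.1 * R := rfl
@[simp] theorem act_snd (R : Mat p p) (z : Pair m n p) : (act R z).2 = z.2 * R⁻¹ᵀ := rfl

theorem act_act_inv {R : Mat p p} (hR : IsUnit R.det) (z : Pair m n p) :
    act R (act R⁻¹ z) = z := by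
  have h1 := Matrix.nonsing_inv_mul _ hR
  ext1
  · simp [Matrix.mul_assoc, h1]
  · simp [Matrix.mul_assoc, Matrix.nonsing_inv_nonsing_inv _ hR, ← Matrix.transpose_mul, h1]

theorem act_inv_act {R : Mat p p} (hR : IsUnit R.det) (z : Pair m n p) :
    act R⁻¹ (act R z) = z := by
  have h1 := act_act_inv (Matrix.isUnit_nonsing_inv_det _ hR) z
  rwa [Matrix.nonsing_inv_nonsing_inv _ hR] at h1

theorem mul_transpose_act {R : Mat p p} (hR : IsUnit R.det) (z w : Pair m n p) :
    (act R z).1 * (act R w).2ᵀ = z.1 * w.2ᵀ := by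
  have h1 := Matrix.mul_nonsing_inv _ hR
  simp only [act_fst, act_snd, Matrix.transpose_mul, Matrix.transpose_transpose]
  rw [Matrix.mul_assoc, ← Matrix.mul_assoc R, h1, Matrix.one_mul]

theorem proj_act {R : Mat p p} (hR : IsUnit R.det) (z : Pair m n p) : proj (act R z) = proj z :=
  mul_transpose_act hR z z

/-- Multiplying `M Nᵀ = M' N'ᵀ` on the right by `N' (N'ᵀ N')⁻¹` gives `M' = M R`. Exchanging the
roles gives `M = M' R'`, and cancelling `M` yields `R R' = 1`. -/
theorem exists_act_eq {z z' : Pair m n p} (hz : z ∈ Rp m n p) (hz' : z' ∈ Rp m n p)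
    (h : proj z = proj z') : ∃ R : Mat p p, IsUnit R.det ∧ z' = act R z := by
  have key : ∀ {w w' : Pair m n p}, w' ∈ Rp m n p → proj w = proj w' →
      w'.1 = w.1 * (w.2ᵀ * w'.2 * (w'.2ᵀ * w'.2)⁻¹) := fun {w w'} hw' hh => by
    have h2 := Matrix.mul_nonsing_inv _ (isUnit_gram hw'.2)
    calc w'.1 = w'.1 * ((w'.2ᵀ * w'.2) * (w'.2ᵀ * w'.2)⁻¹) := by rw [h2, Matrix.mul_one]
      _ = proj w' * w'.2 * (w'.2ᵀ * w'.2)⁻¹ := by simp only [proj, Matrix.mul_assoc]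
      _ = proj w * w'.2 * (w'.2ᵀ * w'.2)⁻¹ := by rw [hh]
      _ = _ := by simp only [proj, Matrix.mul_assoc]
  have cancel : ∀ {a : ℕ} {A B : Mat p a}, z.1 * A = z.1 * B → A = B := fun {a A B} hh => by
    have h3 := Matrix.nonsing_inv_mul _ (isUnit_gram hz.1)
    have : ∀ C : Mat p a, C = (z.1ᵀ * z.1)⁻¹ * (z.1ᵀ * (z.1 * C)) := fun C => by
      rw [← Matrix.mul_assoc z.1ᵀ, ← Matrix.mul_assoc, h3, Matrix.one_mul]
    rw [this A, this B, hh]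
  have k1 := key hz' h
  have k2 := key hz h.symm
  set R := z.2ᵀ * z'.2 * (z'.2ᵀ * z'.2)⁻¹
  set R' := z'.2ᵀ * z.2 * (z.2ᵀ * z.2)⁻¹
  have hRR : R * R' = 1 := cancel (by rw [← Matrix.mul_assoc, ← k1, ← k2, Matrix.mul_one])
  have hR : IsUnit R.det := Matrix.isUnit_det_of_right_inverse hRR
  refine ⟨R, hR, Prod.ext k1 ?_⟩
  have k3 : z.2ᵀ = R * z'.2ᵀ := cancel (by
    rw [← Matrix.mul_assoc, ← k1]; exact h)
  have k4 : z.2 = z'.2 * Rᵀ := by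
    rw [← Matrix.transpose_transpose z.2, k3, Matrix.transpose_mul, Matrix.transpose_transpose]
  rw [act_snd, k4, Matrix.mul_assoc, ← Matrix.transpose_mul, Matrix.nonsing_inv_mul _ hR,
    Matrix.transpose_one, Matrix.mul_one]

end FixedRank

/-! ### Square roots of Gram matrices and local sections of `proj`. -/

namespace FixedRank
variable {m n p : ℕ}

theorem sq_norm_eq_trace {a b : ℕ} (A : Mat a b) : ‖A‖ ^ 2 = (Aᵀ * A).trace := by
  have h : 0 ≤ ∑ i, ∑ j, ‖A i j‖ ^ (2 : ℝ) := by positivity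
  rw [Matrix.frobenius_norm_def, ← Real.sqrt_eq_rpow, Real.sq_sqrt h, Finset.sum_comm]
  simp [Matrix.trace, Matrix.mul_apply, sq]

open scoped MatrixOrder in
/-- The positive square root of a Gram matrix. -/
theorem exists_gram_sqrt {a : ℕ} (M : Mat a p) :
    ∃ S : Mat p p, Sᵀ = S ∧ S * S = Mᵀ * M ∧ ‖S - 1‖ ≤ ‖Mᵀ * M - 1‖ := by
  have hG : (Mᵀ * M).PosSemidef := by
    simpa using Matrix.posSemidef_conjTranspose_mul_self M
  set S := CFC.sqrt (Mᵀ * M)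
  have hS : S.PosSemidef := Matrix.nonneg_iff_posSemidef.1 (CFC.sqrt_nonneg (Mᵀ * M))
  have hSS : S * S = Mᵀ * M := CFC.sqrt_mul_sqrt_self _ hG.nonneg
  have hSt : Sᵀ = S := by simpa using hS.isHermitian.eq
  refine ⟨S, hSt, hSS, ?_⟩
  rw [← hSS]
  have hDt : (S - 1)ᵀ = S - 1 := by simp [hSt]
  have h1 : 0 ≤ ((S * (S - 1))ᵀ * (S * (S - 1))).trace := by
    rw [← sq_norm_eq_trace]; positivity
  have h2 : 0 ≤ ((S - 1) * S * (S - 1)).trace := by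
    have := (hS.conjTranspose_mul_mul_same (S - 1)).trace_nonneg
    simpa [hSt] using this
  refine le_of_sq_le_sq ?_ (norm_nonneg _)
  rw [sq_norm_eq_trace, sq_norm_eq_trace]
  -- Expand the square of `S² - 1 = (S - 1) + S (S - 1)`; the traces of the extra terms are
  -- nonnegative, the cross term because `S` is positive semidefinite. This controls `S` near `1`
  -- without differentiating the square root.
  have h3 : (S * S - 1)ᵀ * (S * S - 1) = (S - 1)ᵀ * (S - 1)
      + (S * (S - 1))ᵀ * (S * (S - 1)) + (2 : ℝ) • ((S - 1) * S * (S - 1)) := by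
    simp only [Matrix.transpose_mul, Matrix.transpose_sub, hSt, Matrix.transpose_one, two_smul]
    noncomm_ring
  rw [h3, Matrix.trace_add, Matrix.trace_add, Matrix.trace_smul, smul_eq_mul]
  linarith

theorem isUnit_sqrt {S G : Mat p p} (h : S * S = G) (hG : IsUnit G.det) : IsUnit S.det := by
  rw [← h, Matrix.det_mul] at hG
  exact isUnit_of_mul_isUnit_left hG

theorem orthonormalize {a : ℕ} {M : Mat a p} {S : Mat p p} (hSt : Sᵀ = S) (hS : S * S = Mᵀ * M)
    (hu : IsUnit S.det) : (M * S⁻¹)ᵀ * (M * S⁻¹) = 1 := by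
  rw [Matrix.transpose_mul, Matrix.mul_assoc, ← Matrix.mul_assoc Mᵀ, ← hS,
    Matrix.transpose_nonsing_inv, hSt, Matrix.mul_assoc S, Matrix.mul_nonsing_inv _ hu,
    Matrix.mul_one, Matrix.nonsing_inv_mul _ hu]

/-- An orthonormal left factor determines a factorization in `SRp m n p`. -/
theorem mem_SRp_of_orthonormal {X : Mat m n} (hX : X ∈ Mp m n p) {M : Mat m p} (hM : Mᵀ * M = 1)
    {L : Mat p n} (hL : X = M * L) : (M, Xᵀ * M) ∈ SRp m n p ∧ proj (M, Xᵀ * M) = X := by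
  have h1 : proj (M, Xᵀ * M) = X := by
    simp only [proj, Matrix.transpose_mul, Matrix.transpose_transpose]
    conv_lhs => rw [hL, ← Matrix.mul_assoc Mᵀ, hM, Matrix.one_mul]
    exact hL.symm
  refine ⟨⟨hM, le_antisymm ?_ ?_⟩, h1⟩
  · simpa using Matrix.rank_le_width (Xᵀ * M)
  · have h2 : X.rank = p := hX
    rw [← h1, proj] at h2
    calc p = _ := h2.symm
      _ ≤ _ := Matrix.rank_mul_le_right _ _
      _ = _ := Matrix.rank_transpose _

/-- The columns of `M` form a basis of the column space of `X`, and `N` holds the coordinates of the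
columns of `X` in it. -/
theorem exists_mem_Rp {X : Mat m n} (hX : X ∈ Mp m n p) : ∃ z ∈ Rp m n p, proj z = X := by
  have hr : Module.finrank ℝ (LinearMap.range X.mulVecLin) = p := hX
  let b := Module.finBasisOfFinrankEq ℝ (LinearMap.range X.mulVecLin) hr
  have hmem : ∀ k, X.col k ∈ LinearMap.range X.mulVecLin :=
    fun k => ⟨Pi.single k 1, by simp⟩
  let M : Mat m p := Matrix.of fun i j => (b j : Fin m → ℝ) i
  let N : Mat n p := Matrix.of fun k j => b.repr ⟨_, hmem k⟩ j
  have hXe : proj (M, N) = X := by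
    ext i k
    have h1 := congrArg Subtype.val (b.sum_repr ⟨_, hmem k⟩)
    have h2 := congrFun h1 i
    simp only [Submodule.coe_sum, Submodule.coe_smul, Finset.sum_apply, Pi.smul_apply,
      smul_eq_mul, Matrix.col_apply] at h2
    refine Eq.trans ?_ h2
    rw [proj, Matrix.mul_apply]
    exact Finset.sum_congr rfl fun j _ => mul_comm (M i j) (N k j)
  have hX' : (M * Nᵀ).rank = p := (congrArg Matrix.rank hXe).trans hX
  refine ⟨(M, N), ⟨le_antisymm (by simpa using Matrix.rank_le_width M) ?_,
    le_antisymm (by simpa using Matrix.rank_le_width N) ?_⟩, hXe⟩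
  · exact hX'.ge.trans (Matrix.rank_mul_le_left _ _)
  · exact hX'.ge.trans ((Matrix.rank_mul_le_right _ _).trans (Matrix.rank_transpose _).le)

theorem exists_mem_SRp {X : Mat m n} (hX : X ∈ Mp m n p) : ∃ z ∈ SRp m n p, proj z = X := by
  obtain ⟨z, hz, rfl⟩ := exists_mem_Rp hX
  obtain ⟨S, hSt, hS, -⟩ := exists_gram_sqrt z.1
  have hu := isUnit_sqrt hS (isUnit_gram hz.1)
  exact ⟨_, mem_SRp_of_orthonormal hX (orthonormalize hSt hS hu) (L := S * z.2ᵀ) (by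
    rw [Matrix.mul_assoc, ← Matrix.mul_assoc _ S, Matrix.nonsing_inv_mul _ hu, Matrix.one_mul]
    rfl)⟩

/-- A section of the map `proj : SRp m n p → Mp m n p` near a point, Lipschitz at that point. -/
theorem exists_local_section {z₀ : Pair m n p} (hz₀ : z₀ ∈ SRp m n p) :
    ∃ C, ∀ᶠ X in 𝓝 (proj z₀), X ∈ Mp m n p →
      ∃ z ∈ SRp m n p, proj z = X ∧ ‖z - z₀‖ ≤ C * ‖X - proj z₀‖ := by
  set Xs := proj z₀ with hXs
  -- `K` is a right inverse of `z₀.2ᵀ`, so `Xs * K` is the left factor at `z₀`. For nearby `X` the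
  -- left factor will be `X * K`, orthonormalized by the root of its Gram matrix.
  set K : Mat n p := z₀.2 * (z₀.2ᵀ * z₀.2)⁻¹ with hK
  have hXK : Xs * K = z₀.1 := by
    rw [hXs, hK, proj, Matrix.mul_assoc, ← Matrix.mul_assoc z₀.2ᵀ,
      Matrix.mul_nonsing_inv _ (isUnit_gram hz₀.2), Matrix.mul_one]
  have hN : Xsᵀ * z₀.1 = z₀.2 := by
    rw [hXs, proj, Matrix.transpose_mul, Matrix.transpose_transpose, Matrix.mul_assoc, hz₀.1,
      Matrix.mul_one]
  -- Keeping the square root as an independent variable makes the section smooth in `(X, S)`;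
  -- differentiability of `Θ` at `(Xs, 1)` and a linear bound on `S - 1` then suffice.
  let Θ : Mat m n × Mat p p → Pair m n p := fun q => (q.1 * K * q.2⁻¹, q.1ᵀ * (q.1 * K * q.2⁻¹))
  have hΘ0 : Θ (Xs, 1) = z₀ := by simp [Θ, hXK, hN]
  have hinv : ContDiffAt ℝ 1 (fun q : Mat m n × Mat p p => q.2⁻¹) (Xs, 1) :=
    contDiffAt_snd.matrix_inv (by simp)
  have hΘ : ContDiffAt ℝ 1 Θ (Xs, 1) := by
    have h1 : ContDiffAt ℝ 1 (fun q : Mat m n × Mat p p => q.1 * K * q.2⁻¹) (Xs, 1) :=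
      (contDiffAt_fst.matrix_mul contDiffAt_const).matrix_mul hinv
    exact h1.prodMk (contDiffAt_fst.matrix_transpose.matrix_mul h1)
  obtain ⟨c, hc⟩ := (hΘ.differentiableAt (by norm_num)).isBigO_sub.bound
  obtain ⟨r, hr, hball⟩ := Metric.eventually_nhds_iff_ball.1 hc
  have hG : ContDiffAt ℝ 1 (fun X : Mat m n => (X * K)ᵀ * (X * K)) Xs := by fun_prop
  obtain ⟨d, hd⟩ := (hG.differentiableAt (by norm_num)).isBigO_sub.bound
  have hrank : ∀ᶠ X in 𝓝 Xs, (X * K).rank = p := by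
    have h1 : ContinuousAt (fun X : Mat m n => X * K) Xs :=
      (show ContDiffAt ℝ 1 (fun X : Mat m n => X * K) Xs by fun_prop).continuousAt
    refine h1.eventually ((isOpen_rank_eq m p).mem_nhds ?_)
    simp only [hXK, Set.mem_ofPred_eq]
    exact (SRp_subset_Rp hz₀).1
  have hsmall : ∀ᶠ X in 𝓝 Xs, (1 + |d|) * ‖X - Xs‖ < r := by
    have h1 : ContinuousAt (fun X : Mat m n => (1 + |d|) * ‖X - Xs‖) Xs := by fun_prop
    exact h1.eventually (gt_mem_nhds (by simpa using hr))
  refine ⟨|c| * (1 + |d|), ?_⟩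
  filter_upwards [hd, hrank, hsmall] with X h1 h2 h3 hX
  obtain ⟨w, hw, rfl⟩ := exists_mem_Rp hX
  obtain ⟨S, hSt, hS, hSb⟩ := exists_gram_sqrt (proj w * K)
  have hu := isUnit_sqrt hS (isUnit_gram h2)
  -- Here `X * K = w.1 * (w.2ᵀ * K)`; as the last factor is invertible, `X` is recovered as a
  -- multiple of `X * K` from the right.
  have hT : IsUnit (w.2ᵀ * K).det := by
    rw [← Matrix.isUnit_iff_isUnit_det]
    have h4 : (w.2ᵀ * K).rank = p := le_antisymm (by simpa using Matrix.rank_le_width (w.2ᵀ * K)) (by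
      rw [proj, Matrix.mul_assoc] at h2
      exact h2.ge.trans (Matrix.rank_mul_le_right _ _))
    have h5 := isUnit_gram h4
    rw [Matrix.det_mul] at h5
    exact (Matrix.isUnit_iff_isUnit_det _).2 (isUnit_of_mul_isUnit_right h5)
  obtain ⟨hmem, hproj⟩ := mem_SRp_of_orthonormal hX (orthonormalize hSt hS hu)
    (L := S * ((w.2ᵀ * K)⁻¹ * w.2ᵀ)) (by
      rw [Matrix.mul_assoc, ← Matrix.mul_assoc _ S, Matrix.nonsing_inv_mul _ hu, Matrix.one_mul,
        proj, Matrix.mul_assoc w.1, Matrix.mul_assoc w.1, ← Matrix.mul_assoc (w.2ᵀ * K),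
        Matrix.mul_nonsing_inv _ hT, Matrix.one_mul])
  refine ⟨_, hmem, hproj, ?_⟩
  have hXsK : (Xs * K)ᵀ * (Xs * K) = 1 := by rw [hXK, hz₀.1]
  rw [hXsK] at h1
  have hq : ‖(proj w, S) - (Xs, 1)‖ ≤ (1 + |d|) * ‖proj w - Xs‖ := by
    have h6 : d * ‖proj w - Xs‖ ≤ |d| * ‖proj w - Xs‖ := by gcongr; exact le_abs_self d
    have h7 := norm_nonneg (proj w - Xs)
    have h8 : 0 ≤ |d| * ‖proj w - Xs‖ := by positivity
    rw [Prod.mk_sub_mk, Prod.norm_mk, max_le_iff]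
    constructor <;> linarith
  have h9 := hball (proj w, S) (by rw [Metric.mem_ball, dist_eq_norm]; exact hq.trans_lt h3)
  rw [hΘ0] at h9
  calc _ ≤ c * ‖(proj w, S) - (Xs, 1)‖ := h9
    _ ≤ |c| * ‖(proj w, S) - (Xs, 1)‖ := by gcongr; exact le_abs_self c
    _ ≤ |c| * ((1 + |d|) * ‖proj w - Xs‖) := by gcongr
    _ = _ := by ring

end FixedRank

/-! ### The Hessian of the lifted function at a critical point. -/

theorem fderiv_fderiv_apply_of_fderiv_eq_zero {E F : Type*} [NormedAddCommGroup E]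
    [NormedSpace ℝ E] [FiniteDimensional ℝ E] [NormedAddCommGroup F] [NormedSpace ℝ F] {f : E → F}
    {z : E} (hf : ContDiffAt ℝ ∞ f z) (h0 : fderiv ℝ f z = 0) (L : E →ₗ[ℝ] E) (u : E) :
    fderiv ℝ (fun w => fderiv ℝ f w (L w)) z u = fderiv ℝ (fun w => fderiv ℝ f w (L z)) z u := by
  have h1 : HasFDerivAt (fderiv ℝ f) (fderiv ℝ (fderiv ℝ f) z) z :=
    ((hf.fderiv_right (m := 1) (by norm_cast)).differentiableAt (by norm_num)).hasFDerivAt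
  have h2 := h1.clm_apply (LinearMap.toContinuousLinearMap L).hasFDerivAt
  have h3 := h1.clm_apply (hasFDerivAt_const (L z) z)
  have e2 := h2.fderiv
  have e3 := h3.fderiv
  simp only [LinearMap.coe_toContinuousLinearMap'] at e2
  -- Letting the vector vary with the point adds only the term `fderiv ℝ f z (L u)`, which vanishes
  -- at a critical point.
  rw [e2, e3, h0]
  simp

theorem Matrix.linearMap_apply_eq_trace {a b : Type*} [Fintype a] [Fintype b] [DecidableEq a]
    [DecidableEq b] (l : Matrix a b ℝ →ₗ[ℝ] ℝ) (A : Matrix a b ℝ) :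
    l A = ((Matrix.of fun i j => l (Matrix.single i j 1))ᵀ * A).trace := by
  conv_lhs => rw [Matrix.matrix_eq_sum_single A]
  simp only [map_sum, Matrix.trace, Matrix.diag_apply, Matrix.mul_apply, Matrix.transpose_apply,
    Matrix.of_apply]
  rw [Finset.sum_comm]
  refine Finset.sum_congr rfl fun j _ => Finset.sum_congr rfl fun i _ => ?_
  have : Matrix.single i j (A i j) = A i j • Matrix.single i j (1 : ℝ) := by simp
  rw [this, map_smul, smul_eq_mul, mul_comm]

namespace FixedRank
variable {m n p : ℕ}

/-- The differential of `proj`. -/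
def dproj (z : Pair m n p) : Pair m n p →ₗ[ℝ] Mat m n where
  toFun v := v.1 * z.2ᵀ + z.1 * v.2ᵀ
  map_add' v w := by simp [Matrix.add_mul, Matrix.mul_add]; abel
  map_smul' c v := by simp

theorem dproj_apply (z v : Pair m n p) : dproj z v = v.1 * z.2ᵀ + z.1 * v.2ᵀ := rfl

theorem hasFDerivAt_proj (z : Pair m n p) :
    HasFDerivAt proj (LinearMap.toContinuousLinearMap (dproj z)) z := by
  have h2 : HasFDerivAt (fun w : Pair m n p => w.2ᵀ)
      (LinearMap.toContinuousLinearMap ((Matrix.transposeLinearEquiv (Fin n) (Fin p) ℝ ℝ).toLinearMap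
        ∘ₗ LinearMap.snd ℝ (Mat m p) (Mat n p))) z :=
    (LinearMap.toContinuousLinearMap
      ((Matrix.transposeLinearEquiv (Fin n) (Fin p) ℝ ℝ).toLinearMap
        ∘ₗ LinearMap.snd ℝ (Mat m p) (Mat n p))).hasFDerivAt
  obtain ⟨h', h3, h4⟩ := (hasFDerivAt_fst (𝕜 := ℝ) (p := z)).matrix_mul h2
  have h5 : h' = LinearMap.toContinuousLinearMap (dproj z) := by
    refine ContinuousLinearMap.ext fun v => ?_
    rw [h4]
    exact add_comm _ _
  rw [← h5]
  exact h3

theorem contDiffAt_proj {k : WithTop ℕ∞} (z : Pair m n p) : ContDiffAt ℝ k proj z := by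
  unfold proj
  fun_prop

theorem dproj_mem {z : Pair m n p} (hz : z ∈ Rp m n p) (v : Pair m n p) :
    dproj z v ∈ tangentSpace (proj z) := (mem_tangentSpace_proj hz _).2 ⟨v, rfl⟩

theorem exists_dproj_eq {z : Pair m n p} (hz : z ∈ Rp m n p) {ξ : Mat m n}
    (hξ : ξ ∈ tangentSpace (proj z)) : ∃ v, dproj z v = ξ := by
  obtain ⟨w, hw⟩ := (mem_tangentSpace_proj hz _).1 hξ
  exact ⟨w, hw.symm⟩

section SmoothOnMp
variable {F : Type*} [NormedAddCommGroup F] [NormedSpace ℝ F] {φ : Mat m n → F}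

/-- Near `z` the map `proj` takes values in `Mp`, where `φ` agrees with its local extension `Φ`, so
the composition is locally `Φ ∘ proj`. -/
theorem SmoothOnMp.contDiffAt_comp_proj (hφ : SmoothOnMp p φ) {z : Pair m n p}
    (hz : z ∈ Rp m n p) : ContDiffAt ℝ ∞ (fun w : Pair m n p => φ (proj w)) z := by
  obtain ⟨V, hV, hzV, Φ, hΦ, heq⟩ := hφ _ (proj_mem hz)
  have h1 : ContDiffAt ℝ ∞ (fun w : Pair m n p => Φ (proj w)) z :=
    (hΦ.contDiffAt (hV.mem_nhds hzV)).comp z (contDiffAt_proj z)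
  refine h1.congr_of_eventuallyEq ?_
  have hc : ContinuousAt (proj : Pair m n p → Mat m n) z :=
    (contDiffAt_proj (k := 1) z).continuousAt
  filter_upwards [hc.eventually (hV.mem_nhds hzV), isOpen_Rp.mem_nhds hz] with w h2 h3
  exact (heq _ ⟨h2, proj_mem h3⟩).symm

theorem SmoothOnMp.hasFDerivWithinAt (hφ : SmoothOnMp p φ) {X : Mat m n} (hX : X ∈ Mp m n p) :
    HasFDerivWithinAt φ (diffMp p φ X) (Mp m n p) X := by
  obtain ⟨V, hV, hzV, Φ, hΦ, heq⟩ := hφ X hX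
  refine DifferentiableWithinAt.hasFDerivWithinAt ?_
  have h1 : DifferentiableWithinAt ℝ Φ (Mp m n p) X :=
    ((hΦ.contDiffAt (hV.mem_nhds hzV)).differentiableAt (by simp)).differentiableWithinAt
  refine h1.congr_of_eventuallyEq ?_ (heq X ⟨hzV, hX⟩).symm
  filter_upwards [mem_nhdsWithin_of_mem_nhds (hV.mem_nhds hzV), self_mem_nhdsWithin] with Y h2 h3
  exact (heq Y ⟨h2, h3⟩).symm

/-- Since `proj` maps a neighbourhood of `z` into `Mp`, the chain rule holds for any derivative
within `Mp`; uniqueness of that derivative plays no role. -/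
theorem SmoothOnMp.fderiv_comp_proj (hφ : SmoothOnMp p φ) {z : Pair m n p} (hz : z ∈ Rp m n p)
    (v : Pair m n p) :
    fderiv ℝ (fun w : Pair m n p => φ (proj w)) z v = diffMp p φ (proj z) (dproj z v) := by
  have h1 := hφ.hasFDerivWithinAt (proj_mem hz)
  have h2 : HasFDerivAt (φ ∘ proj)
      ((diffMp p φ (proj z)).comp (LinearMap.toContinuousLinearMap (dproj z))) z :=
    HasFDerivWithinAt.comp_hasFDerivAt z h1 (hasFDerivAt_proj z)
      (by filter_upwards [isOpen_Rp.mem_nhds hz] with w hw using proj_mem hw)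
  exact DFunLike.congr_fun h2.fderiv v

end SmoothOnMp

/-- The lift to pairs of factors of the vector field `X ↦ A X + X B`. -/
def linLift (A : Mat m m) (B : Mat n n) : Pair m n p →ₗ[ℝ] Pair m n p where
  toFun z := (A * z.1, Bᵀ * z.2)
  map_add' _ _ := by simp [Matrix.mul_add]
  map_smul' _ _ := by simp

theorem dproj_linLift (A : Mat m m) (B : Mat n n) (z : Pair m n p) :
    dproj z (linLift A B z) = A * proj z + proj z * B := by
  simp [dproj_apply, linLift, proj, Matrix.mul_assoc, Matrix.transpose_mul]

theorem isVectorField_lin (A : Mat m m) (B : Mat n n) :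
    IsVectorField p fun X : Mat m n => A * X + X * B := by
  refine ⟨fun X _ => ⟨Set.univ, isOpen_univ, trivial, _, ?_, fun _ _ => rfl⟩,
    fun X _ => ⟨A, B, rfl⟩⟩
  refine ContDiff.contDiffOn (contDiff_iff_contDiffAt.2 fun Y => ?_)
  fun_prop

/-- The second derivative of the lifted function. -/
noncomputable def hessLifted (f : Mat m n → ℝ) (z u v : Pair m n p) : ℝ :=
  fderiv ℝ (fun w => fderiv ℝ (lifted f) w v) z u

section Hessian
variable {f : Mat m n → ℝ} {z : Pair m n p}

theorem contDiffAt_lifted (hf : SmoothOnMp p f) (hz : z ∈ Rp m n p) :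
    ContDiffAt ℝ ∞ (lifted f : Pair m n p → ℝ) z := hf.contDiffAt_comp_proj hz

theorem fderiv_lifted (hf : SmoothOnMp p f) (hz : z ∈ Rp m n p) (v : Pair m n p) :
    fderiv ℝ (lifted f) z v = diffMp p f (proj z) (dproj z v) := hf.fderiv_comp_proj hz v

theorem fderiv_lifted_eq_zero_of_dproj (hf : SmoothOnMp p f) (hz : z ∈ Rp m n p) {v : Pair m n p}
    (hv : dproj z v = 0) : fderiv ℝ (lifted f) z v = 0 := by
  rw [fderiv_lifted hf hz, hv, map_zero]

/-- In terms of the lifted function, `X = M Nᵀ` is a nondegenerate critical point if the first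
derivative vanishes at `z = (M, N)` and the kernel of the second one consists of the vertical
vectors. -/
structure IsLiftedNondegenerate (f : Mat m n → ℝ) (z : Pair m n p) : Prop where
  fderiv_eq_zero : fderiv ℝ (lifted f) z = 0
  hess_eq_zero : ∀ u v, dproj z v = 0 → hessLifted f z u v = 0
  dproj_eq_zero : ∀ u, (∀ v, hessLifted f z u v = 0) → dproj z u = 0

variable {g : Mat m n → Mat m n → Mat m n → ℝ}

theorem IsNondegenerateCriticalPoint.lifted (hf : SmoothOnMp p f) (hg : IsRiemannianMetric p g)
    (hz : z ∈ Rp m n p) (h : IsNondegenerateCriticalPoint p g f (proj z)) :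
    IsLiftedNondegenerate f z := by
  obtain ⟨hX, G, del, hG, hdel, hG0, hess, hhess⟩ := h
  have hzero_left : ∀ ζ ∈ tangentSpace (proj z), g (proj z) 0 ζ = 0 := fun ζ hζ => by
    simpa using hg.smul_left _ hX 0 0 (zero_mem _) ζ hζ
  have hzero_right : ∀ ζ ∈ tangentSpace (proj z), g (proj z) ζ 0 = 0 := fun ζ hζ => by
    rw [hg.symm _ hX _ hζ _ (zero_mem _), hzero_left ζ hζ]
  have h1 : fderiv ℝ (FixedRank.lifted f) z = 0 := by
    refine ContinuousLinearMap.ext fun v => ?_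
    rw [fderiv_lifted hf hz, ← hG.2 _ hX _ (dproj_mem hz v), hG0, hzero_left _ (dproj_mem hz v)]
    rfl
  -- The fields `X ↦ A X + X B` realize every tangent vector and lift to linear fields. In `D_χ g(G,
  -- ζ) = g(∇_χ G, ζ) + g(G, ∇_χ ζ)` the last term dies because `G` vanishes at the point, and the
  -- left side lifts to a derivative of `d f̄` along a linear field.
  have key : ∀ u v, hessLifted f z u v
      = g (proj z) (hess ⟨dproj z u, dproj_mem hz u⟩) (dproj z v) := fun u v => by
    obtain ⟨A, B, hAB⟩ := dproj_mem hz u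
    have hA' : ∃ (A' : Mat m m) (B' : Mat n n), linLift A' B' z = v := by
      refine ⟨v.1 * (z.1ᵀ * z.1)⁻¹ * z.1ᵀ, (v.2 * (z.2ᵀ * z.2)⁻¹ * z.2ᵀ)ᵀ, ?_⟩
      have e1 := Matrix.nonsing_inv_mul _ (isUnit_gram hz.1)
      have e2 := Matrix.nonsing_inv_mul _ (isUnit_gram hz.2)
      ext1
      · simp only [linLift, LinearMap.coe_mk, AddHom.coe_mk]
        rw [Matrix.mul_assoc, Matrix.mul_assoc, e1, Matrix.mul_one]
      · simp only [linLift, LinearMap.coe_mk, AddHom.coe_mk, Matrix.transpose_transpose]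
        rw [Matrix.mul_assoc, Matrix.mul_assoc, e2, Matrix.mul_one]
    obtain ⟨A', B', rfl⟩ := hA'
    have hχ := isVectorField_lin (p := p) A B
    have hζ := isVectorField_lin (p := p) A' B'
    have hm := hdel.metric_compatible _ _ _ hχ hG.1 hζ _ hX
    rw [hG0, hzero_left _ ((hdel.isVectorField _ _ hχ hζ).2 _ hX), add_zero,
      hhess ⟨dproj z u, dproj_mem hz u⟩ _ hχ hAB.symm, ← hAB, ← dproj_linLift A' B' z,
      ← (hg.smooth _ _ hG.1 hζ).fderiv_comp_proj hz] at hm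
    rw [← hm, hessLifted]
    refine (fderiv_fderiv_apply_of_fderiv_eq_zero (contDiffAt_lifted hf hz) h1
      (linLift A' B') u).symm.trans ?_
    refine DFunLike.congr_fun (Filter.EventuallyEq.fderiv_eq ?_) u
    filter_upwards [isOpen_Rp.mem_nhds hz] with w hw
    refine (fderiv_lifted hf hw _).trans ?_
    rw [hG.2 _ (proj_mem hw) _ (hζ.2 _ (proj_mem hw)), dproj_linLift]
  refine ⟨h1, fun u v hv => ?_, fun u hu => ?_⟩
  · rw [key, hv, hzero_right _ (Subtype.mem _)]
  -- Testing with a lift of the Hessian value itself turns the hypothesis into `g(h, h) = 0`.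
  · obtain ⟨v, hv⟩ := exists_dproj_eq hz (hess ⟨dproj z u, dproj_mem hz u⟩).2
    have h2 := hu v
    rw [key, hv] at h2
    have h3 : (hess ⟨dproj z u, dproj_mem hz u⟩ : Mat m n) = 0 := by
      by_contra hne
      exact (hg.pos _ hX _ (Subtype.mem _) hne).ne' h2
    have h4 : hess ⟨dproj z u, dproj_mem hz u⟩ = 0 := Subtype.ext h3
    exact congrArg Subtype.val (hess.map_eq_zero_iff.1 h4)

end Hessian

/-! ### Euclidean gradient of the lifted function -/

theorem fderiv_eq_oMetric (F : Pair m n p → ℝ) (z v : Pair m n p) :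
    fderiv ℝ F z v = oMetric (partialM F z, partialN F z) v := by
  have h1 := Matrix.linearMap_apply_eq_trace
    ((fderiv ℝ F z).toLinearMap ∘ₗ LinearMap.inl ℝ (Mat m p) (Mat n p)) v.1
  have h2 := Matrix.linearMap_apply_eq_trace
    ((fderiv ℝ F z).toLinearMap ∘ₗ LinearMap.inr ℝ (Mat m p) (Mat n p)) v.2
  have h3 : v = (v.1, 0) + (0, v.2) := by simp
  conv_lhs => rw [h3, map_add]
  rw [oMetric, Matrix.trace_add]
  exact congrArg₂ (· + ·) h1 h2

theorem contDiffAt_partialM {F : Pair m n p → ℝ} {z : Pair m n p} (hF : ContDiffAt ℝ ∞ F z) :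
    ContDiffAt ℝ ∞ (partialM F) z := by
  have h : partialM F = fun w => ∑ i, ∑ j,
      fderiv ℝ F w (Matrix.single i j 1, 0) • (Matrix.single i j 1 : Mat m p) := by
    ext1 w
    rw [Matrix.matrix_eq_sum_single (partialM F w)]
    simp [partialM]
  rw [h]
  exact ContDiffAt.sum fun i _ => ContDiffAt.sum fun j _ =>
    (hF.fderiv_apply_const _).smul contDiffAt_const

theorem contDiffAt_partialN {F : Pair m n p → ℝ} {z : Pair m n p} (hF : ContDiffAt ℝ ∞ F z) :
    ContDiffAt ℝ ∞ (partialN F) z := by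
  have h : partialN F = fun w => ∑ i, ∑ j,
      fderiv ℝ F w (0, Matrix.single i j 1) • (Matrix.single i j 1 : Mat n p) := by
    ext1 w
    rw [Matrix.matrix_eq_sum_single (partialN F w)]
    simp [partialN]
  rw [h]
  exact ContDiffAt.sum fun i _ => ContDiffAt.sum fun j _ =>
    (hF.fderiv_apply_const _).smul contDiffAt_const

theorem oMetric_ext {a b : Pair m n p} (h : ∀ v, oMetric a v = oMetric b v) : a = b := by
  ext1
  · refine Matrix.transpose_injective (Matrix.ext_iff_trace_mul_right.2 fun x => ?_)
    simpa [oMetric] using h (x, 0)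
  · refine Matrix.transpose_injective (Matrix.ext_iff_trace_mul_right.2 fun x => ?_)
    simpa [oMetric] using h (0, x)

/-- `oMetric` is linear in the first argument. -/
def oMetricLeft (v : Pair m n p) : Pair m n p →ₗ[ℝ] ℝ where
  toFun u := oMetric u v
  map_add' a b := by simp [oMetric, Matrix.add_mul]; ring
  map_smul' c a := by simp [oMetric]; ring

/-- The Euclidean gradient of the lifted function. -/
noncomputable def egrad (f : Mat m n → ℝ) (z : Pair m n p) : Pair m n p :=
  (partialM (lifted f) z, partialN (lifted f) z)

theorem contDiffAt_egrad {f : Mat m n → ℝ} (hf : SmoothOnMp p f) {z : Pair m n p}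
    (hz : z ∈ Rp m n p) : ContDiffAt ℝ ∞ (egrad f : Pair m n p → Pair m n p) z :=
  (contDiffAt_partialM (contDiffAt_lifted hf hz)).prodMk
    (contDiffAt_partialN (contDiffAt_lifted hf hz))

theorem fderiv_lifted_eq_oMetric (f : Mat m n → ℝ) (z v : Pair m n p) :
    fderiv ℝ (lifted f) z v = oMetric (egrad f z) v := fderiv_eq_oMetric _ z v

theorem oMetric_fderiv_egrad {f : Mat m n → ℝ} (hf : SmoothOnMp p f) {z : Pair m n p}
    (hz : z ∈ Rp m n p) (u v : Pair m n p) :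
    oMetric (fderiv ℝ (egrad f) z u) v = hessLifted f z u v := by
  have h1 := ((contDiffAt_egrad hf hz).differentiableAt (by simp)).hasFDerivAt
  have h2 := (LinearMap.toContinuousLinearMap (oMetricLeft v)).hasFDerivAt.comp z h1
  have h3 : (fun w => fderiv ℝ (lifted f) w v) = (LinearMap.toContinuousLinearMap (oMetricLeft v)) ∘
      (egrad f) := by
    ext1 w
    exact fderiv_lifted_eq_oMetric f w v
  rw [hessLifted, h3]
  exact (DFunLike.congr_fun h2.fderiv u).symm

end FixedRank

/-- The derivative of an equivariant map is equivariant. -/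
theorem fderiv_apply_of_equivariant {E F : Type*} [NormedAddCommGroup E] [NormedSpace ℝ E]
    [FiniteDimensional ℝ E] [NormedAddCommGroup F] [NormedSpace ℝ F] [FiniteDimensional ℝ F]
    {Y : E → F} {L : E →ₗ[ℝ] E} {L' : F →ₗ[ℝ] F} {z : E} (h : ∀ᶠ w in 𝓝 z, Y (L w) = L' (Y w))
    (h1 : DifferentiableAt ℝ Y z) (h2 : DifferentiableAt ℝ Y (L z)) (u : E) :
    fderiv ℝ Y (L z) (L u) = L' (fderiv ℝ Y z u) := by
  have h3 : HasFDerivAt (fun w => Y (L w)) _ z := HasFDerivAt.comp z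
    (f := LinearMap.toContinuousLinearMap L) h2.hasFDerivAt
    (LinearMap.toContinuousLinearMap L).hasFDerivAt
  have h4 : HasFDerivAt (fun w => L' (Y w)) _ z :=
    (LinearMap.toContinuousLinearMap L').hasFDerivAt.comp z h1.hasFDerivAt
  exact DFunLike.congr_fun (h3.unique (h4.congr_of_eventuallyEq h)) u

/-! ### Iteration (A): the Newton equation on full-rank factors. -/

namespace FixedRank
variable {m n p : ℕ} {f : Mat m n → ℝ} {z : Pair m n p}

/-! ### Vertical vectors -/

/-- The parametrization of the vertical space. -/
def vert (z : Pair m n p) : Mat p p →ₗ[ℝ] Pair m n p where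
  toFun R := (z.1 * R, -(z.2 * Rᵀ))
  map_add' A B := by ext1 <;> simp [Matrix.mul_add]; abel
  map_smul' c A := by simp

theorem vert_apply (z : Pair m n p) (R : Mat p p) : vert z R = (z.1 * R, -(z.2 * Rᵀ)) := rfl

theorem mem_vertical {v : Pair m n p} : v ∈ vertical z ↔ ∃ R, v = vert z R := Iff.rfl

theorem dproj_vert (z : Pair m n p) (R : Mat p p) : dproj z (vert z R) = 0 := by
  simp [dproj_apply, vert_apply, Matrix.mul_assoc, Matrix.transpose_mul]

theorem eq_zero_of_mul_eq_zero {a b c : ℕ} {M : Mat a b} (hM : M.rank = b) {A : Mat b c}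
    (h : M * A = 0) : A = 0 := by
  have h1 := Matrix.nonsing_inv_mul _ (isUnit_gram hM)
  rw [← Matrix.one_mul A, ← h1, Matrix.mul_assoc, Matrix.mul_assoc, h, Matrix.mul_zero,
    Matrix.mul_zero]

theorem vert_injective (hz : z ∈ Rp m n p) {R : Mat p p} (h : vert z R = 0) : R = 0 :=
  eq_zero_of_mul_eq_zero hz.1 (congrArg Prod.fst h)

/-- Solving `Ṁ Nᵀ + M Ṅᵀ = 0` for `Ṁ` with the right inverse `N (NᵀN)⁻¹` of `Nᵀ` gives `Ṁ = M R`;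
cancelling `M` then gives `Ṅ`. -/
theorem exists_vert_of_dproj (hz : z ∈ Rp m n p) {u : Pair m n p} (h : dproj z u = 0) :
    ∃ R, u = vert z R := by
  rw [dproj_apply] at h
  have h1 := Matrix.mul_nonsing_inv _ (isUnit_gram hz.2)
  have h2 : u.1 = z.1 * (-(u.2ᵀ * z.2 * (z.2ᵀ * z.2)⁻¹)) := by
    have h3 := congrArg (fun A => A * (z.2 * (z.2ᵀ * z.2)⁻¹)) h
    simp only [Matrix.add_mul, Matrix.zero_mul] at h3
    rw [Matrix.mul_assoc, ← Matrix.mul_assoc z.2ᵀ, h1, Matrix.mul_one] at h3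
    rw [Matrix.mul_neg, eq_neg_iff_add_eq_zero, ← h3]
    simp only [Matrix.mul_assoc]
  set R := -(u.2ᵀ * z.2 * (z.2ᵀ * z.2)⁻¹)
  refine ⟨R, Prod.ext h2 ?_⟩
  have h4 : R * z.2ᵀ + u.2ᵀ = 0 := eq_zero_of_mul_eq_zero hz.1 (by
    rw [Matrix.mul_add, ← Matrix.mul_assoc, ← h2, h])
  have h5 := congrArg Matrix.transpose h4
  simp only [Matrix.transpose_add, Matrix.transpose_mul, Matrix.transpose_transpose,
    Matrix.transpose_zero] at h5
  rw [vert_apply]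
  exact eq_neg_of_add_eq_zero_right h5

/-! ### The metric on `Rp m n p` -/

theorem metric_factor_nonneg {a : ℕ} {M : Mat a p} (hM : M.rank = p) (x : Mat a p) :
    0 ≤ ((Mᵀ * M)⁻¹ * xᵀ * x).trace ∧ (((Mᵀ * M)⁻¹ * xᵀ * x).trace = 0 → x = 0) := by
  have hu := isUnit_gram hM
  -- With `B = x (MᵀM)⁻¹ Mᵀ` one has `B Bᵀ = x (MᵀM)⁻¹ xᵀ`, which exhibits the trace as a square
  -- without a root of the inverse Gram matrix.
  have h1 : ‖(x * (Mᵀ * M)⁻¹ * Mᵀ)ᵀ‖ ^ 2 = ((Mᵀ * M)⁻¹ * xᵀ * x).trace := by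
    rw [sq_norm_eq_trace, Matrix.transpose_transpose, Matrix.trace_mul_comm _ x,
      ← Matrix.mul_assoc x]
    congr 1
    simp only [Matrix.transpose_mul, Matrix.transpose_transpose, Matrix.transpose_nonsing_inv]
    calc _ = x * ((Mᵀ * M)⁻¹ * (Mᵀ * M)) * (Mᵀ * M)⁻¹ * xᵀ := by simp only [Matrix.mul_assoc]
      _ = _ := by rw [Matrix.nonsing_inv_mul _ hu, Matrix.mul_one]
  refine ⟨h1 ▸ sq_nonneg _, fun h => ?_⟩
  rw [h, sq_eq_zero_iff, norm_eq_zero, Matrix.transpose_eq_zero] at h1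
  calc x = x * ((Mᵀ * M)⁻¹ * (Mᵀ * M)) := by rw [Matrix.nonsing_inv_mul _ hu, Matrix.mul_one]
    _ = (x * (Mᵀ * M)⁻¹ * Mᵀ) * M := by simp only [Matrix.mul_assoc]
    _ = 0 := by rw [h1, Matrix.zero_mul]

theorem eq_zero_of_metric_self (hz : z ∈ Rp m n p) {v : Pair m n p} (h : metric z v v = 0) :
    v = 0 := by
  rw [metric, Matrix.trace_add] at h
  have h1 := metric_factor_nonneg hz.1 v.1
  have h2 := metric_factor_nonneg hz.2 v.2
  exact Prod.ext (h1.2 (by linarith [h1.1, h2.1])) (h2.2 (by linarith [h1.1, h2.1]))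

theorem metric_mul_gram (hz : z ∈ Rp m n p) (e v : Pair m n p) :
    metric z (e.1 * (z.1ᵀ * z.1), e.2 * (z.2ᵀ * z.2)) v = oMetric e v := by
  have h : ∀ {a : ℕ} {M : Mat a p} (_ : M.rank = p) (x : Mat a p),
      (Mᵀ * M)⁻¹ * (x * (Mᵀ * M))ᵀ = xᵀ := fun {a M} hM x => by
    rw [Matrix.transpose_mul, Matrix.transpose_mul, Matrix.transpose_transpose,
      ← Matrix.mul_assoc (Mᵀ * M)⁻¹, Matrix.nonsing_inv_mul _ (isUnit_gram hM), Matrix.one_mul]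
  simp only [metric, oMetric, h hz.1, h hz.2]

/-- It vanishes on exactly the horizontal vectors. -/
noncomputable def horDefect (z : Pair m n p) : Pair m n p →ₗ[ℝ] Mat p p where
  toFun u := (z.1ᵀ * z.1)⁻¹ * u.1ᵀ * z.1 - z.2ᵀ * u.2 * (z.2ᵀ * z.2)⁻¹
  map_add' u v := by simp [Matrix.add_mul, Matrix.mul_add]; abel
  map_smul' c u := by simp [smul_sub]

theorem horDefect_apply (z u : Pair m n p) :
    horDefect z u = (z.1ᵀ * z.1)⁻¹ * u.1ᵀ * z.1 - z.2ᵀ * u.2 * (z.2ᵀ * z.2)⁻¹ := rfl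

theorem metric_vert (z u : Pair m n p) (R : Mat p p) :
    metric z u (vert z R) = (horDefect z u * R).trace := by
  simp only [metric, vert_apply, horDefect_apply, Matrix.sub_mul, Matrix.trace_sub,
    Matrix.mul_neg, ← sub_eq_add_neg]
  congr 1
  · simp only [Matrix.mul_assoc]
  · rw [← Matrix.trace_transpose]
    simp only [Matrix.transpose_mul, Matrix.transpose_transpose, Matrix.transpose_nonsing_inv]
    rw [Matrix.mul_assoc, Matrix.trace_mul_comm]
    simp only [Matrix.mul_assoc]

theorem mem_horizontal {u : Pair m n p} : u ∈ horizontal z ↔ horDefect z u = 0 := by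
  refine ⟨fun h => Matrix.ext_iff_trace_mul_right.2 fun R => ?_, fun h v hv => ?_⟩
  · rw [← metric_vert, h (vert z R) ⟨R, rfl⟩]; simp
  · obtain ⟨R, rfl⟩ := mem_vertical.1 hv
    rw [metric_vert, h]; simp

/-! ### The lifted gradient and the connection -/

theorem contDiffAt_gradLifted (hf : SmoothOnMp p f) (hz : z ∈ Rp m n p) :
    ContDiffAt ℝ ∞ (gradLifted f : Pair m n p → Pair m n p) z := by
  have h := contDiffAt_egrad hf hz
  have h1 : ContDiffAt ℝ ∞ (partialM (lifted f) : Pair m n p → Mat m p) z := h.fst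
  have h2 : ContDiffAt ℝ ∞ (partialN (lifted f) : Pair m n p → Mat n p) z := h.snd
  unfold gradLifted
  fun_prop

/-- The lifted function is constant along fibres, so its derivative kills vertical vectors. -/
theorem gradLifted_mem_horizontal (hf : SmoothOnMp p f) (hz : z ∈ Rp m n p) :
    gradLifted f z ∈ horizontal z := fun v hv => by
  obtain ⟨R, rfl⟩ := mem_vertical.1 hv
  refine (metric_mul_gram hz (egrad f z) _).trans ?_
  rw [← fderiv_lifted_eq_oMetric, fderiv_lifted_eq_zero_of_dproj hf hz (dproj_vert z R)]

theorem egrad_eq_zero (h : IsLiftedNondegenerate f z) : egrad f z = 0 :=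
  oMetric_ext fun v => by
    rw [← fderiv_lifted_eq_oMetric, h.fderiv_eq_zero]
    simp [oMetric]

theorem gradLifted_eq_zero (h : IsLiftedNondegenerate f z) : gradLifted f z = 0 := by
  have h1 : partialM (lifted f) z = 0 := congrArg Prod.fst (egrad_eq_zero h)
  have h2 : partialN (lifted f) z = 0 := congrArg Prod.snd (egrad_eq_zero h)
  rw [gradLifted, h1, h2]
  simp

/-- The derivatives of the Gram factors are multiplied by the Euclidean gradient, which is zero at
`z`. -/
theorem fderiv_gradLifted (hf : SmoothOnMp p f) (hz : z ∈ Rp m n p)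
    (h : IsLiftedNondegenerate f z) (u : Pair m n p) :
    fderiv ℝ (gradLifted f) z u = ((fderiv ℝ (egrad f) z u).1 * (z.1ᵀ * z.1),
      (fderiv ℝ (egrad f) z u).2 * (z.2ᵀ * z.2)) := by
  have h0 := ((contDiffAt_egrad hf hz).differentiableAt (by simp)).hasFDerivAt
  have g1 : DifferentiableAt ℝ (fun w : Pair m n p => w.1ᵀ * w.1) z :=
    (show ContDiffAt ℝ 1 (fun w : Pair m n p => w.1ᵀ * w.1) z by fun_prop).differentiableAt
      (by norm_num)
  have g2 : DifferentiableAt ℝ (fun w : Pair m n p => w.2ᵀ * w.2) z :=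
    (show ContDiffAt ℝ 1 (fun w : Pair m n p => w.2ᵀ * w.2) z by fun_prop).differentiableAt
      (by norm_num)
  obtain ⟨d1, hd1, e1⟩ := h0.fst.matrix_mul g1.hasFDerivAt
  obtain ⟨d2, hd2, e2⟩ := h0.snd.matrix_mul g2.hasFDerivAt
  have h3 : HasFDerivAt (gradLifted f) (d1.prod d2) z := hd1.prodMk hd2
  have hz0 := egrad_eq_zero h
  refine (DFunLike.congr_fun h3.fderiv u).trans (Prod.ext ?_ ?_)
  · refine (e1 u).trans ?_
    rw [hz0, Prod.fst_zero, Matrix.zero_mul, zero_add]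
    rfl
  · refine (e2 u).trans ?_
    rw [hz0, Prod.snd_zero, Matrix.zero_mul, zero_add]
    rfl

theorem metric_fderiv_gradLifted (hf : SmoothOnMp p f) (hz : z ∈ Rp m n p)
    (h : IsLiftedNondegenerate f z) (u v : Pair m n p) :
    metric z (fderiv ℝ (gradLifted f) z u) v = hessLifted f z u v := by
  rw [fderiv_gradLifted hf hz h, metric_mul_gram hz, oMetric_fderiv_egrad hf hz]

theorem symPart_add (A B : Mat p p) : symPart (A + B) = symPart A + symPart B := by
  simp only [symPart, Matrix.transpose_add, ← smul_add]; congr 1; abel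

theorem symPart_smul (c : ℝ) (A : Mat p p) : symPart (c • A) = c • symPart A := by
  simp only [symPart, Matrix.transpose_smul, ← smul_add, smul_comm c]

theorem symPart_zero : symPart (0 : Mat p p) = 0 := by simp [symPart]

theorem connFactor_add {a : ℕ} (M x x' y d d' : Mat a p) :
    connFactor M (x + x') y (d + d') = connFactor M x y d + connFactor M x' y d' := by
  simp only [connFactor, Matrix.transpose_add, Matrix.add_mul, symPart_add, Matrix.mul_add]
  abel

theorem connFactor_smul {a : ℕ} (c : ℝ) (M x y d : Mat a p) :
    connFactor M (c • x) y (c • d) = c • connFactor M x y d := by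
  simp only [connFactor, Matrix.transpose_smul, Matrix.smul_mul, symPart_smul, Matrix.mul_smul,
    smul_add, smul_sub]

theorem connFactor_zero {a : ℕ} (M x d : Mat a p) : connFactor M x 0 d = d := by
  simp [connFactor, symPart_zero]

theorem conn_add (Y : Pair m n p → Pair m n p) (z u v : Pair m n p) :
    conn Y z (u + v) = conn Y z u + conn Y z v := by
  simp only [conn, map_add, Prod.fst_add, Prod.snd_add, connFactor_add, Prod.mk_add_mk]

theorem conn_smul (Y : Pair m n p → Pair m n p) (c : ℝ) (z u : Pair m n p) :
    conn Y z (c • u) = c • conn Y z u := by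
  simp only [conn, map_smul, Prod.smul_fst, Prod.smul_snd, connFactor_smul, Prod.smul_mk]

theorem contDiffAt_connFactor {a : ℕ} {E : Type*} [NormedAddCommGroup E] [NormedSpace ℝ E]
    {k : WithTop ℕ∞} {w : E} {M x y d : E → Mat a p} (hM : ContDiffAt ℝ k M w)
    (hx : ContDiffAt ℝ k x w) (hy : ContDiffAt ℝ k y w) (hd : ContDiffAt ℝ k d w)
    (hu : (M w).rank = p) : ContDiffAt ℝ k (fun q => connFactor (M q) (x q) (y q) (d q)) w := by
  have hi : ContDiffAt ℝ k (fun q => ((M q)ᵀ * M q)⁻¹) w :=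
    ContDiffAt.matrix_inv (hM.matrix_transpose.matrix_mul hM) (isUnit_gram hu)
  set G := fun q => ((M q)ᵀ * M q)⁻¹
  change ContDiffAt ℝ k (fun q => d q - y q * G q * symPart ((x q)ᵀ * M q)
    - x q * G q * symPart ((y q)ᵀ * M q) + M q * G q * symPart ((x q)ᵀ * y q)) w
  fun_prop

/-! ### The Newton equation as a square linear system -/

/-- The Newton equation at `z` reads `newtonOp f z (u, R) = (-grad, 0)`. -/
noncomputable def newtonOp (f : Mat m n → ℝ) (z : Pair m n p) :
    (Pair m n p × Mat p p) →ₗ[ℝ] (Pair m n p × Mat p p) where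
  toFun x := (conn (gradLifted f) z x.1 - vert z x.2, horDefect z x.1)
  map_add' x y := by
    simp only [Prod.fst_add, Prod.snd_add, map_add, conn_add, add_sub_add_comm, Prod.mk_add_mk]
  map_smul' c x := by
    simp only [Prod.smul_fst, Prod.smul_snd, map_smul, conn_smul, smul_sub, Prod.smul_mk,
      RingHom.id_apply]

theorem newtonOp_apply (f : Mat m n → ℝ) (z : Pair m n p) (x : Pair m n p × Mat p p) :
    newtonOp f z x = (conn (gradLifted f) z x.1 - vert z x.2, horDefect z x.1) := rfl

theorem contDiffAt_newtonOp (hf : SmoothOnMp p f) (hz : z ∈ Rp m n p)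
    (x : Pair m n p × Mat p p) : ContDiffAt ℝ ∞ (fun w => newtonOp f w x) z := by
  have hY := contDiffAt_gradLifted hf hz
  have hD := hY.fderiv_apply_const x.1
  have h1 : ContDiffAt ℝ ∞ (fun w => conn (gradLifted f) w x.1) z :=
    (contDiffAt_connFactor contDiffAt_fst contDiffAt_const hY.fst hD.fst hz.1).prodMk
      (contDiffAt_connFactor contDiffAt_snd contDiffAt_const hY.snd hD.snd hz.2)
  have h2 : ContDiffAt ℝ ∞ (fun w : Pair m n p => vert w x.2) z := by
    simp only [vert_apply]; fun_prop
  have h3 : ContDiffAt ℝ ∞ (fun w : Pair m n p => horDefect w x.1) z := by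
    have i1 : ContDiffAt ℝ ∞ (fun w : Pair m n p => (w.1ᵀ * w.1)⁻¹) z :=
      ContDiffAt.matrix_inv (by fun_prop) (isUnit_gram hz.1)
    have i2 : ContDiffAt ℝ ∞ (fun w : Pair m n p => (w.2ᵀ * w.2)⁻¹) z :=
      ContDiffAt.matrix_inv (by fun_prop) (isUnit_gram hz.2)
    exact ((i1.matrix_mul contDiffAt_const).matrix_mul contDiffAt_fst).sub
      ((contDiffAt_snd.matrix_transpose.matrix_mul contDiffAt_const).matrix_mul i2)
  exact (h1.sub h2).prodMk h3

/-- As `-grad` is already horizontal, the projected equation only says that `∇_u grad + grad` is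
some `vert z R`. The extra unknown `R` balances the `p × p` horizontality condition, so the system
is square. -/
theorem isNewtonVector_iff (hf : SmoothOnMp p f) (hz : z ∈ Rp m n p) (u : Pair m n p) :
    IsNewtonVector horizontal vertical conn (gradLifted f) z u ↔
      ∃ R, newtonOp f z (u, R) = (-gradLifted f z, 0) := by
  have hY : -gradLifted f z ∈ horizontal z := by
    rw [mem_horizontal, map_neg, mem_horizontal.1 (gradLifted_mem_horizontal hf hz), neg_zero]
  simp only [IsNewtonVector, IsHorizontalProj, mem_horizontal.1 hY, mem_horizontal, true_and,
    mem_vertical, newtonOp_apply, Prod.mk.injEq, exists_and_right, sub_eq_iff_eq_add]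
  rw [and_comm]
  simp only [add_comm]

theorem conn_gradLifted (h : IsLiftedNondegenerate f z) (u : Pair m n p) :
    conn (gradLifted f) z u = fderiv ℝ (gradLifted f) z u := by
  rw [conn, gradLifted_eq_zero h, Prod.fst_zero, Prod.snd_zero, connFactor_zero, connFactor_zero]

/-- The first component reads `Y'(x.1 - e) = vert z x.2`. Paired with this vertical vector itself it
gives zero, because the Hessian ignores vertical directions; so the multiplier vanishes, `x.1 - e`
is in the kernel of the Hessian, and nondegeneracy applies. -/
theorem newtonOp_key (hf : SmoothOnMp p f) (hz : z ∈ Rp m n p) (h : IsLiftedNondegenerate f z)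
    {e : Pair m n p} {x : Pair m n p × Mat p p}
    (hx : newtonOp f z x = (fderiv ℝ (gradLifted f) z e, 0)) :
    x.2 = 0 ∧ dproj z x.1 = dproj z e := by
  have h1 : conn (gradLifted f) z x.1 - vert z x.2 = fderiv ℝ (gradLifted f) z e :=
    congrArg Prod.fst hx
  rw [conn_gradLifted h, sub_eq_iff_eq_add, ← sub_eq_iff_eq_add', ← map_sub] at h1
  have h2 : vert z x.2 = 0 := eq_zero_of_metric_self hz (by
    conv_lhs => rw [← h1, h1]
    rw [← h1, metric_fderiv_gradLifted hf hz h, h1, h.hess_eq_zero _ _ (dproj_vert _ _)])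
  refine ⟨vert_injective hz h2, ?_⟩
  rw [← sub_eq_zero, ← map_sub]
  refine h.dproj_eq_zero _ fun v => ?_
  rw [← metric_fderiv_gradLifted hf hz h, h1, h2]
  simp [metric]

/-- With `e = 0` the solution is vertical as well as horizontal. -/
theorem newtonOp_injective (hf : SmoothOnMp p f) (hz : z ∈ Rp m n p)
    (h : IsLiftedNondegenerate f z) {x : Pair m n p × Mat p p} (hx : newtonOp f z x = 0) :
    x = 0 := by
  obtain ⟨h1, h2⟩ := newtonOp_key hf hz h (e := 0) (x := x) (by rw [hx, map_zero]; rfl)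
  rw [map_zero] at h2
  obtain ⟨R, hR⟩ := exists_vert_of_dproj hz h2
  have h3 : x.1 ∈ horizontal z := mem_horizontal.2 (congrArg Prod.snd hx)
  have h4 : x.1 = 0 := eq_zero_of_metric_self hz (h3 _ ⟨R, hR⟩)
  exact Prod.ext h4 h1

theorem newtonStep_local (hf : SmoothOnMp p f) (hz : z ∈ Rp m n p)
    (h : IsLiftedNondegenerate f z) :
    ∃ C, ∀ᶠ w in 𝓝 z, w ∈ Rp m n p → ∃ u,
      IsNewtonVector horizontal vertical conn (gradLifted f) w u ∧
      (∀ u', IsNewtonVector horizontal vertical conn (gradLifted f) w u' → u' = u) ∧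
      proj (w + u) ∈ Mp m n p ∧ ‖proj (w + u) - proj z‖ ≤ C * ‖w - z‖ ^ 2 := by
  have hr : HasFDerivAt (fun q : Pair m n p × Pair m n p => proj (q.1 + q.2))
      ((LinearMap.toContinuousLinearMap (dproj z)).comp
        (ContinuousLinearMap.fst ℝ _ _ + ContinuousLinearMap.snd ℝ _ _)) (z, 0) := by
    have h1 := hasFDerivAt_proj (z + 0)
    rw [add_zero] at h1
    refine HasFDerivAt.comp (g := proj) (z, 0) ?_ (hasFDerivAt_fst.add hasFDerivAt_snd)
    simp only [add_zero]
    exact h1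
  have := exists_newton_step_bound (z₀ := z) (T := Rp m n p)
    (newton := IsNewtonVector horizontal vertical conn (gradLifted f))
    (retr := fun w u => proj (w + u)) (M := Mp m n p) (Y := gradLifted f) (A := newtonOp f)
    (π := dproj z)
    (fun x => (contDiffAt_newtonOp hf hz x).of_le (by norm_cast))
    (fun x => newtonOp_injective hf hz h)
    ((contDiffAt_gradLifted hf hz).of_le (by norm_cast)) (gradLifted_eq_zero h)
    (Eventually.of_forall fun w hw => isNewtonVector_iff hf hw)
    ((contDiffAt_proj _).comp (z, 0) (contDiffAt_fst.add contDiffAt_snd))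
    (fun a b => DFunLike.congr_fun hr.fderiv (a, b))
    (by
      have hc : ContinuousAt (fun q : Pair m n p × Pair m n p => q.1 + q.2) (z, 0) := by fun_prop
      refine (hc.eventually (isOpen_Rp.mem_nhds (by simpa using hz))).mono fun q hq => proj_mem hq)
    (fun e x hx => (newtonOp_key hf hz h hx).2)
  simp only [add_zero] at this
  exact this

end FixedRank

/-! ### Block matrices and the exponential map of iteration (B). -/

section BlockMatrices

variable {E : Type*} [NormedAddCommGroup E] [NormedSpace ℝ E] {k : WithTop ℕ∞} {x : E}
  {a b c d : Type*} [Fintype a] [Fintype b] [Fintype c] [Fintype d]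

theorem ContDiffAt.matrix_fromBlocks {A : E → Matrix a c ℝ} {B : E → Matrix a d ℝ}
    {C : E → Matrix b c ℝ} {D : E → Matrix b d ℝ} (hA : ContDiffAt ℝ k A x)
    (hB : ContDiffAt ℝ k B x) (hC : ContDiffAt ℝ k C x) (hD : ContDiffAt ℝ k D x) :
    ContDiffAt ℝ k (fun y => Matrix.fromBlocks (A y) (B y) (C y) (D y)) x := by
  let L : (Matrix a c ℝ × Matrix a d ℝ × Matrix b c ℝ × Matrix b d ℝ) →ₗ[ℝ]
      Matrix (a ⊕ b) (c ⊕ d) ℝ :=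
    { toFun := fun q => Matrix.fromBlocks q.1 q.2.1 q.2.2.1 q.2.2.2
      map_add' := fun q r => by simp [Matrix.fromBlocks_add]
      map_smul' := fun t q => by simp [Matrix.fromBlocks_smul] }
  exact L.contDiffAt_comp (hA.prodMk (hB.prodMk (hC.prodMk hD)))

theorem ContDiffAt.matrix_fromCols {A : E → Matrix a b ℝ} {B : E → Matrix a c ℝ}
    (hA : ContDiffAt ℝ k A x) (hB : ContDiffAt ℝ k B x) :
    ContDiffAt ℝ k (fun y => Matrix.fromCols (A y) (B y)) x := by
  let L : (Matrix a b ℝ × Matrix a c ℝ) →ₗ[ℝ] Matrix a (b ⊕ c) ℝ :=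
    { toFun := fun q => Matrix.fromCols q.1 q.2
      map_add' := fun q r => by ext i (j | j) <;> rfl
      map_smul' := fun t q => by ext i (j | j) <;> rfl }
  exact L.contDiffAt_comp (hA.prodMk hB)

attribute [local instance] Matrix.frobeniusNormedRing Matrix.frobeniusNormedAlgebra

/-- An intertwining relation passes through the exponential series. `D` need not be invertible,
which allows `diag(1, t)` with `t = 0`. -/
theorem Matrix.mul_exp_of_mul_eq [DecidableEq a] {D B B' : Matrix a a ℝ} (h : D * B = B' * D) :
    D * NormedSpace.exp B = NormedSpace.exp B' * D := by
  have : CompleteSpace (Matrix a a ℝ) := FiniteDimensional.complete ℝ _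
  let _ : NormedAlgebra ℚ (Matrix a a ℝ) := NormedAlgebra.restrictScalars ℚ ℝ _
  exact SemiconjBy.exp_right (show SemiconjBy D B B' from h)

end BlockMatrices

namespace FixedRank
variable {m n p : ℕ} {f : Mat m n → ℝ} {z : Pair m n p}

/-! ### The exponential map -/

/-- The first factor of the Riemannian exponential along a ray. -/
theorem oExp_smul_fst (z u : Pair m n p) (t : ℝ) :
    (oExp z (t • u)).1 = Matrix.fromCols z.1 u.1
      * NormedSpace.exp (t • Matrix.fromBlocks (z.1ᵀ * u.1) (-(u.1ᵀ * u.1)) (1 : Mat p p)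
          (z.1ᵀ * u.1))
      * Matrix.fromRows (1 : Mat p p) (0 : Mat p p) * NormedSpace.exp (t • (-(z.1ᵀ * u.1))) := by
  -- `D = diag(1, t)` intertwines the block matrix of `t • u` with `t` times that of `u`, so the ray
  -- becomes a curve `exp (t B)` between constant factors.
  let D : Matrix (Fin p ⊕ Fin p) (Fin p ⊕ Fin p) ℝ :=
    Matrix.fromBlocks (1 : Mat p p) 0 0 (t • (1 : Mat p p))
  have h1 : Matrix.fromCols z.1 (t • u.1) = Matrix.fromCols z.1 u.1 * D := by
    simp [D, Matrix.fromCols_mul_fromBlocks]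
  have h2 : D * Matrix.fromRows (1 : Mat p p) (0 : Mat p p) = Matrix.fromRows 1 0 := by
    simp [D, Matrix.fromBlocks_mul_fromRows]
  have h3 := Matrix.mul_exp_of_mul_eq (D := D)
    (B := Matrix.fromBlocks (z.1ᵀ * (t • u.1)) (-((t • u.1)ᵀ * (t • u.1))) (1 : Mat p p)
      (z.1ᵀ * (t • u.1)))
    (B' := t • Matrix.fromBlocks (z.1ᵀ * u.1) (-(u.1ᵀ * u.1)) (1 : Mat p p) (z.1ᵀ * u.1)) (by
      simp [D, Matrix.fromBlocks_multiply, Matrix.fromBlocks_smul])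
  simp only [oExp, Prod.smul_fst]
  rw [h1, Matrix.mul_assoc _ D, h3, ← Matrix.mul_assoc, Matrix.mul_assoc _ D, h2,
    Matrix.mul_smul, smul_neg]

theorem oExp_zero (z : Pair m n p) : oExp z 0 = z := by
  have h := oExp_smul_fst z 0 0
  rw [smul_zero] at h
  refine Prod.ext (h.trans ?_) ?_
  · simp [Matrix.fromCols_mul_fromRows]
  · simp [oExp]

theorem hasDerivAt_oExp_smul (z u : Pair m n p) :
    HasDerivAt (fun t : ℝ => oExp z (t • u)) u 0 := by
  set B : Matrix (Fin p ⊕ Fin p) (Fin p ⊕ Fin p) ℝ :=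
    Matrix.fromBlocks (z.1ᵀ * u.1) (-(u.1ᵀ * u.1)) (1 : Mat p p) (z.1ᵀ * u.1) with hB
  have h1 : HasDerivAt (fun t : ℝ => (oExp z (t • u)).1) u.1 0 := by
    have e1 := ((hasDerivAt_const (0 : ℝ) (Matrix.fromCols z.1 u.1)).matrix_mul
      (Matrix.hasDerivAt_exp_smul_zero B)).matrix_mul
      (hasDerivAt_const (0 : ℝ) (Matrix.fromRows (1 : Mat p p) (0 : Mat p p)))
    have e2 := e1.matrix_mul (Matrix.hasDerivAt_exp_smul_zero (-(z.1ᵀ * u.1)))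
    simp only [zero_smul, NormedSpace.exp_zero, Matrix.mul_one, Matrix.mul_zero,
      add_zero, zero_add, Matrix.fromCols_mul_fromRows, hB, Matrix.fromCols_mul_fromBlocks] at e2
    -- The block exponential contributes `M A + Ṁ`, and the factor `exp (-A)` removes `M A`.
    have e3 : z.1 * -(z.1ᵀ * u.1) + (z.1 * (z.1ᵀ * u.1) + u.1) = u.1 := by
      rw [Matrix.mul_neg, neg_add_cancel_left]
    rw [e3] at e2
    simp only [oExp_smul_fst]
    exact e2
  have h2 : HasDerivAt (fun t : ℝ => (oExp z (t • u)).2) u.2 0 := by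
    have := ((hasDerivAt_id (0 : ℝ)).smul_const u.2).const_add z.2
    simp only [id_eq, one_smul] at this
    exact this
  exact h1.prodMk h2

theorem contDiffAt_oExp {k : WithTop ℕ∞} (q : Pair m n p × Pair m n p) :
    ContDiffAt ℝ k (fun q : Pair m n p × Pair m n p => oExp q.1 q.2) q := by
  have hA : ContDiffAt ℝ k (fun q : Pair m n p × Pair m n p => q.1.1ᵀ * q.2.1) q := by fun_prop
  have hS : ContDiffAt ℝ k (fun q : Pair m n p × Pair m n p => -(q.2.1ᵀ * q.2.1)) q := by fun_prop
  have h1 := (ContDiffAt.matrix_fromBlocks hA hS (contDiffAt_const (c := (1 : Mat p p)))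
    hA).matrix_exp
  have h2 : ContDiffAt ℝ k
      (fun q : Pair m n p × Pair m n p => Matrix.fromCols q.1.1 q.2.1) q :=
    ContDiffAt.matrix_fromCols (by fun_prop) (by fun_prop)
  exact (((h2.matrix_mul h1).matrix_mul contDiffAt_const).matrix_mul hA.neg.matrix_exp).prodMk
    (by fun_prop)

/-- Split `(a, b) = (a, 0) + (0, b)`: on zero vectors `oExp` returns the base point, and along rays
its velocity is `b`. The formula is smooth on all pairs, so orthonormality is not needed. -/
theorem fderiv_oExp (z a b : Pair m n p) :
    fderiv ℝ (fun q : Pair m n p × Pair m n p => oExp q.1 q.2) (z, 0) (a, b) = a + b := by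
  have h := ((contDiffAt_oExp (k := 1) (z, (0 : Pair m n p))).differentiableAt
    (by norm_num)).hasFDerivAt
  have h1 := HasFDerivAt.comp (f := fun w => (w, (0 : Pair m n p))) z h
    (hasFDerivAt_prodMk_left z (0 : Pair m n p))
  have h2 : HasFDerivAt ((fun q : Pair m n p × Pair m n p => oExp q.1 q.2) ∘
      fun w => (w, (0 : Pair m n p))) (ContinuousLinearMap.id ℝ _) z := by
    have : ((fun q : Pair m n p × Pair m n p => oExp q.1 q.2) ∘ fun w => (w, (0 : Pair m n p)))
        = id := by ext1 w; exact oExp_zero w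
    rw [this]
    exact hasFDerivAt_id z
  have e1 := DFunLike.congr_fun (h1.unique h2) a
  have h3 : HasDerivAt (fun t : ℝ => (z, t • b)) ((0, b) : Pair m n p × Pair m n p) 0 := by
    have := (hasDerivAt_id (0 : ℝ)).smul_const b
    simp only [id_eq, one_smul] at this
    exact (hasDerivAt_const (0 : ℝ) z).prodMk this
  have h' : HasFDerivAt (fun q : Pair m n p × Pair m n p => oExp q.1 q.2)
      (fderiv ℝ (fun q : Pair m n p × Pair m n p => oExp q.1 q.2) (z, 0)) (z, (0 : ℝ) • b) := by
    rw [zero_smul]; exact h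
  have h4 := h'.comp_hasDerivAt (0 : ℝ) h3
  have e2 := h4.unique (hasDerivAt_oExp_smul z b)
  have e3 : ((a, b) : Pair m n p × Pair m n p) = (a, 0) + (0, b) := by simp
  rw [e3, map_add]
  exact congrArg₂ (· + ·) e1 e2

end FixedRank

/-! ### Iteration (B): the Newton equation with an orthonormal first factor. -/

namespace FixedRank
variable {m n p : ℕ} {f : Mat m n → ℝ} {z : Pair m n p}

/-! ### Symmetric and skew-symmetric parts -/

theorem transpose_symPart (A : Mat p p) : (symPart A)ᵀ = symPart A := by
  simp [symPart, add_comm]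

theorem symPart_of_symm {A : Mat p p} (h : Aᵀ = A) : symPart A = A := by
  rw [symPart, h, ← two_smul ℝ A, smul_smul]; norm_num

theorem symPart_eq_zero_iff {A : Mat p p} : symPart A = 0 ↔ A = -Aᵀ := by
  rw [symPart, smul_eq_zero, or_iff_right (by norm_num), eq_neg_iff_add_eq_zero]

/-- Skew-symmetric part of a square matrix. -/
noncomputable def skewPart (A : Mat p p) : Mat p p := A - symPart A

theorem symPart_sub (A B : Mat p p) : symPart (A - B) = symPart A - symPart B := by
  rw [sub_eq_add_neg, symPart_add, ← neg_one_smul ℝ B, symPart_smul, neg_one_smul, ← sub_eq_add_neg]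

theorem symPart_symPart (A : Mat p p) : symPart (symPart A) = symPart A :=
  symPart_of_symm (transpose_symPart A)

theorem symPart_skewPart (A : Mat p p) : symPart (skewPart A) = 0 := by
  rw [skewPart, symPart_sub, symPart_symPart, sub_self]

theorem skewPart_add (A B : Mat p p) : skewPart (A + B) = skewPart A + skewPart B := by
  simp only [skewPart, symPart_add]; abel

theorem skewPart_smul (c : ℝ) (A : Mat p p) : skewPart (c • A) = c • skewPart A := by
  simp only [skewPart, symPart_smul, smul_sub]

/-- This lets one `p × p` equation hold two conditions: tangency in its symmetric part,
orthogonality to the vertical space in its skew part. -/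
theorem symPart_add_skewPart_eq_zero {A B : Mat p p} :
    symPart A + skewPart B = 0 ↔ symPart A = 0 ∧ skewPart B = 0 := by
  refine ⟨fun h => ?_, fun h => by rw [h.1, h.2, add_zero]⟩
  have h1 := congrArg symPart h
  rw [symPart_add, symPart_symPart, symPart_skewPart, add_zero, symPart_zero] at h1
  rw [h1, zero_add] at h
  exact ⟨h1, h⟩

theorem trace_mul_eq_zero_of_symm_of_skew {S W : Mat p p} (hS : Sᵀ = S) (hW : symPart W = 0) :
    (S * W).trace = 0 := by
  have h1 : (S * W).trace = -(S * W).trace := by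
    conv_lhs => rw [symPart_eq_zero_iff.1 hW, Matrix.mul_neg, Matrix.trace_neg,
      ← Matrix.trace_transpose, Matrix.transpose_mul, Matrix.transpose_transpose, hS,
      Matrix.trace_mul_comm]
  linarith

/-! ### Tangent and horizontal vectors -/

theorem eq_zero_of_oMetric_self {v : Pair m n p} (h : oMetric v v = 0) : v = 0 := by
  rw [oMetric, Matrix.trace_add, ← sq_norm_eq_trace, ← sq_norm_eq_trace] at h
  have h1 := sq_nonneg ‖v.1‖
  have h2 := sq_nonneg ‖v.2‖
  exact Prod.ext (norm_eq_zero.1 (pow_eq_zero_iff two_ne_zero |>.1 (by linarith)))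
    (norm_eq_zero.1 (pow_eq_zero_iff two_ne_zero |>.1 (by linarith)))

theorem mem_oTangent {u : Pair m n p} : u ∈ oTangent z ↔ symPart (z.1ᵀ * u.1) = 0 := by
  rw [symPart_eq_zero_iff, eq_neg_iff_add_eq_zero, Matrix.transpose_mul, Matrix.transpose_transpose]
  rfl

theorem mem_oVertical {v : Pair m n p} :
    v ∈ oVertical z ↔ ∃ W, symPart W = 0 ∧ v = vert z W := by
  refine exists_congr fun W => ?_
  rw [symPart_eq_zero_iff, vert_apply]
  refine and_congr_right fun h => ?_
  rw [show -(z.2 * Wᵀ) = z.2 * W by rw [← Matrix.mul_neg, ← h]]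

theorem vert_mem_oTangent (hz : z ∈ SRp m n p) {W : Mat p p} (hW : symPart W = 0) :
    vert z W ∈ oTangent z := by
  rw [mem_oTangent, vert_apply, ← Matrix.mul_assoc, hz.1, Matrix.one_mul, hW]

theorem oMetric_vert (u : Pair m n p) {W : Mat p p} (hW : symPart W = 0) :
    oMetric u (vert z W) = ((skewPart (z.1ᵀ * u.1 + z.2ᵀ * u.2))ᵀ * W).trace := by
  have h1 : -(z.2 * Wᵀ) = z.2 * W := by
    rw [← Matrix.mul_neg, ← symPart_eq_zero_iff.1 hW]
  have h2 := trace_mul_eq_zero_of_symm_of_skew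
    (transpose_symPart (z.1ᵀ * u.1 + z.2ᵀ * u.2)) hW
  rw [skewPart, Matrix.transpose_sub, transpose_symPart, Matrix.sub_mul, Matrix.trace_sub, h2,
    sub_zero, oMetric, vert_apply, h1]
  simp only [Matrix.transpose_add, Matrix.transpose_mul, Matrix.transpose_transpose,
    Matrix.add_mul, Matrix.mul_assoc]

theorem mem_oHorizontal {u : Pair m n p} : u ∈ oHorizontal z ↔
    symPart (z.1ᵀ * u.1) + skewPart (z.1ᵀ * u.1 + z.2ᵀ * u.2) = 0 := by
  rw [symPart_add_skewPart_eq_zero, ← mem_oTangent]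
  refine and_congr_right fun _ => ⟨fun h => ?_, fun h v hv => ?_⟩
  · have h1 := h _ (mem_oVertical.2 ⟨_, symPart_skewPart (z.1ᵀ * u.1 + z.2ᵀ * u.2), rfl⟩)
    rw [oMetric_vert _ (symPart_skewPart _), ← sq_norm_eq_trace] at h1
    exact norm_eq_zero.1 (pow_eq_zero_iff two_ne_zero |>.1 h1)
  · obtain ⟨W, hW, rfl⟩ := mem_oVertical.1 hv
    rw [oMetric_vert _ hW, h]; simp

theorem symPart_oTangentProj (hz : z ∈ SRp m n p) (w : Pair m n p) :
    symPart (z.1ᵀ * (oTangentProj z w).1) = 0 := by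
  rw [oTangentProj, Matrix.mul_sub, ← Matrix.mul_assoc, hz.1, Matrix.one_mul, symPart_sub,
    symPart_symPart, sub_self]

theorem oTangentProj_of_mem {w : Pair m n p} (hw : symPart (z.1ᵀ * w.1) = 0) :
    oTangentProj z w = w := by
  simp [oTangentProj, hw]

theorem oTangentProj_add (z u v : Pair m n p) :
    oTangentProj z (u + v) = oTangentProj z u + oTangentProj z v := by
  simp only [oTangentProj, Prod.fst_add, Prod.snd_add, Matrix.mul_add, symPart_add,
    Prod.mk_add_mk, add_sub_add_comm]

theorem oTangentProj_smul (c : ℝ) (z u : Pair m n p) :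
    oTangentProj z (c • u) = c • oTangentProj z u := by
  simp only [oTangentProj, Prod.smul_fst, Prod.smul_snd, Matrix.mul_smul, symPart_smul,
    Prod.smul_mk, smul_sub]

theorem oMetric_oTangentProj (w : Pair m n p) {t : Pair m n p} (ht : t ∈ oTangent z) :
    oMetric (oTangentProj z w) t = oMetric w t := by
  have h := trace_mul_eq_zero_of_symm_of_skew (transpose_symPart (z.1ᵀ * w.1)) (mem_oTangent.1 ht)
  rw [← Matrix.mul_assoc] at h
  simp only [oMetric, oTangentProj, Matrix.transpose_sub, Matrix.transpose_mul, transpose_symPart,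
    Matrix.sub_mul, Matrix.trace_add, Matrix.trace_sub, h, sub_zero]

theorem contDiffAt_oTangentProj {E : Type*} [NormedAddCommGroup E] [NormedSpace ℝ E]
    {k : WithTop ℕ∞} {x : E} {w v : E → Pair m n p} (hw : ContDiffAt ℝ k w x)
    (hv : ContDiffAt ℝ k v x) : ContDiffAt ℝ k (fun y => oTangentProj (w y) (v y)) x := by
  have h1 := hw.fst
  have h2 := hv.fst
  refine ContDiffAt.prodMk ?_ hv.snd
  fun_prop

/-! ### The lifted gradient -/

theorem contDiffAt_oGradLifted (hf : SmoothOnMp p f) (hz : z ∈ Rp m n p) :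
    ContDiffAt ℝ ∞ (oGradLifted f : Pair m n p → Pair m n p) z :=
  contDiffAt_oTangentProj contDiffAt_id (contDiffAt_egrad hf hz)

theorem oGradLifted_mem_oHorizontal (hf : SmoothOnMp p f) (hz : z ∈ SRp m n p) :
    oGradLifted f z ∈ oHorizontal z := by
  refine ⟨mem_oTangent.2 (symPart_oTangentProj hz _), fun v hv => ?_⟩
  obtain ⟨W, hW, rfl⟩ := mem_oVertical.1 hv
  refine (oMetric_oTangentProj (egrad f z) (vert_mem_oTangent hz hW)).trans ?_
  rw [← fderiv_lifted_eq_oMetric,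
    fderiv_lifted_eq_zero_of_dproj hf (SRp_subset_Rp hz) (dproj_vert z W)]

theorem oGradLifted_eq_zero (h : IsLiftedNondegenerate f z) : oGradLifted f z = 0 := by
  change oTangentProj z (egrad f z) = 0
  rw [egrad_eq_zero h]
  simp [oTangentProj, symPart_zero]

theorem fderiv_oGradLifted (hf : SmoothOnMp p f) (hz : z ∈ Rp m n p)
    (h : IsLiftedNondegenerate f z) (u : Pair m n p) :
    fderiv ℝ (oGradLifted f) z u = oTangentProj z (fderiv ℝ (egrad f) z u) := by
  have h0 := ((contDiffAt_egrad hf hz).differentiableAt (by simp)).hasFDerivAt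
  have hz0 := egrad_eq_zero h
  have g1 : DifferentiableAt ℝ (fun w : Pair m n p => w.1ᵀ) z :=
    (show ContDiffAt ℝ 1 (fun w : Pair m n p => w.1ᵀ) z by fun_prop).differentiableAt (by norm_num)
  obtain ⟨d1, hd1, e1⟩ := g1.hasFDerivAt.matrix_mul h0.fst
  let L : Mat p p →ₗ[ℝ] Mat p p :=
    { toFun := symPart, map_add' := symPart_add, map_smul' := symPart_smul }
  have hd2 : HasFDerivAt (fun w => symPart (w.1ᵀ * (egrad f w).1)) _ z :=
    (LinearMap.toContinuousLinearMap L).hasFDerivAt.comp z hd1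
  obtain ⟨d3, hd3, e3⟩ := (hasFDerivAt_fst (𝕜 := ℝ) (p := z)).matrix_mul hd2
  have h4 : HasFDerivAt (oGradLifted f) _ z := (h0.fst.sub hd3).prodMk h0.snd
  refine (DFunLike.congr_fun h4.fderiv u).trans (Prod.ext ?_ rfl)
  have e1' : d1 u = z.1ᵀ * (fderiv ℝ (egrad f) z u).1 := by
    refine (e1 u).trans ?_
    rw [hz0, Prod.fst_zero, Matrix.mul_zero, add_zero]
    rfl
  have e3' : d3 u = z.1 * symPart (z.1ᵀ * (fderiv ℝ (egrad f) z u).1) := by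
    refine (e3 u).trans ?_
    rw [hz0, Prod.fst_zero, Matrix.mul_zero, symPart_zero, Matrix.mul_zero, add_zero, ← e1']
    rfl
  exact congrArg (fun a => (fderiv ℝ (egrad f) z u).1 - a) e3'

/-! ### The Newton equation as a square linear system -/

/-- The Newton equation at `z ∈ SRp m n p` reads `oNewtonOp f z (u, Q) = (-grad, 0)`. -/
noncomputable def oNewtonOp (f : Mat m n → ℝ) (z : Pair m n p) :
    (Pair m n p × Mat p p) →ₗ[ℝ] (Pair m n p × Mat p p) where
  toFun x := (oConn (oGradLifted f) z x.1 - vert z (skewPart x.2) + (z.1 * symPart x.2, 0),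
    symPart (z.1ᵀ * x.1.1) + skewPart (z.1ᵀ * x.1.1 + z.2ᵀ * x.1.2))
  map_add' x y := by
    have h : ((z.1 * (symPart x.2 + symPart y.2), 0) : Pair m n p)
        = (z.1 * symPart x.2, 0) + (z.1 * symPart y.2, 0) := by simp [Matrix.mul_add]
    refine Prod.ext ?_ ?_
    · simp only [oConn, Prod.fst_add, Prod.snd_add, map_add, oTangentProj_add, symPart_add,
        skewPart_add, h]
      abel
    · simp only [Prod.fst_add, Prod.snd_add, symPart_add, skewPart_add, Matrix.mul_add]
      abel
  map_smul' c x := by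
    have h : ((z.1 * (c • symPart x.2), 0) : Pair m n p) = c • (z.1 * symPart x.2, 0) := by simp
    refine Prod.ext ?_ ?_
    · simp only [oConn, Prod.smul_fst, Prod.smul_snd, map_smul, oTangentProj_smul, symPart_smul,
        skewPart_smul, h, smul_add, smul_sub, RingHom.id_apply]
    · simp only [Prod.smul_fst, Prod.smul_snd, symPart_smul, skewPart_smul, Matrix.mul_smul,
        ← smul_add, RingHom.id_apply]

theorem oNewtonOp_apply (f : Mat m n → ℝ) (z : Pair m n p) (x : Pair m n p × Mat p p) :
    oNewtonOp f z x =
      (oConn (oGradLifted f) z x.1 - vert z (skewPart x.2) + (z.1 * symPart x.2, 0),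
        symPart (z.1ᵀ * x.1.1) + skewPart (z.1ᵀ * x.1.1 + z.2ᵀ * x.1.2)) := rfl

theorem contDiffAt_oNewtonOp (hf : SmoothOnMp p f) (hz : z ∈ Rp m n p)
    (x : Pair m n p × Mat p p) : ContDiffAt ℝ ∞ (fun w => oNewtonOp f w x) z := by
  have hD := (contDiffAt_oGradLifted hf hz).fderiv_apply_const x.1
  have h1 : ContDiffAt ℝ ∞ (fun w => oConn (oGradLifted f) w x.1) z :=
    contDiffAt_oTangentProj contDiffAt_id hD
  have h2 : ContDiffAt ℝ ∞ (fun w : Pair m n p => vert w (skewPart x.2)) z := by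
    simp only [vert_apply]; fun_prop
  have h3 : ContDiffAt ℝ ∞ (fun w : Pair m n p => ((w.1 * symPart x.2, 0) : Pair m n p)) z := by
    fun_prop
  have h4 : ContDiffAt ℝ ∞ (fun w : Pair m n p => symPart (w.1ᵀ * x.1.1)
      + skewPart (w.1ᵀ * x.1.1 + w.2ᵀ * x.1.2)) z := by
    unfold skewPart; fun_prop
  exact ((h1.sub h2).add h3).prodMk h4

/-- The symmetric part of the multiplier vanishes. -/
theorem symPart_eq_zero_of_tangent_eq (hz : z ∈ SRp m n p) {a b : Pair m n p} {Q : Mat p p}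
    (ha : symPart (z.1ᵀ * a.1) = 0) (hb : symPart (z.1ᵀ * b.1) = 0)
    (h : a - vert z (skewPart Q) + (z.1 * symPart Q, 0) = b) : symPart Q = 0 := by
  rw [← h] at hb
  simp only [Prod.fst_add, Prod.fst_sub, Matrix.mul_add, Matrix.mul_sub, symPart_add, symPart_sub,
    ha, mem_oTangent.1 (vert_mem_oTangent hz (symPart_skewPart Q)), sub_zero, zero_add] at hb
  rwa [← Matrix.mul_assoc, hz.1, Matrix.one_mul, symPart_symPart] at hb

/-- The system acts on all pairs instead of on varying tangent spaces. The skew part of `Q`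
generates the vertical term and the symmetric part a normal term `(M S, 0)`; on `SRp` all other
terms are tangent, which forces `S = 0`. -/
theorem isNewtonVector_ortho_iff (hf : SmoothOnMp p f) (hz : z ∈ SRp m n p) (u : Pair m n p) :
    IsNewtonVector oHorizontal oVertical oConn (oGradLifted f) z u ↔
      ∃ Q, oNewtonOp f z (u, Q) = (-oGradLifted f z, 0) := by
  have hY := oGradLifted_mem_oHorizontal hf hz
  have hYt : symPart (z.1ᵀ * (-oGradLifted f z).1) = 0 := by
    rw [Prod.fst_neg, Matrix.mul_neg, ← neg_one_smul ℝ, symPart_smul, mem_oTangent.1 hY.1, smul_zero]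
  have hY' : -oGradLifted f z ∈ oHorizontal z := by
    refine ⟨mem_oTangent.2 hYt, fun v hv => ?_⟩
    have h1 := hY.2 v hv
    rw [← neg_one_smul ℝ]
    refine ((oMetricLeft v).map_smul _ _).trans ?_
    rw [show oMetricLeft v (oGradLifted f z) = 0 from h1, smul_zero]
  simp only [IsNewtonVector, IsHorizontalProj, hY', mem_oHorizontal (u := u), true_and,
    oNewtonOp_apply, Prod.mk.injEq, exists_and_right, mem_oVertical, sub_neg_eq_add]
  rw [and_comm]
  refine and_congr_left fun _ => ⟨?_, ?_⟩
  · rintro ⟨W, hW, h⟩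
    refine ⟨W, ?_⟩
    have h1 : skewPart W = W := by rw [skewPart, hW, sub_zero]
    rw [hW, h1, ← h, Matrix.mul_zero, Prod.mk_zero_zero, add_zero, sub_add_cancel_left]
  · rintro ⟨Q, h⟩
    have h1 := symPart_eq_zero_of_tangent_eq hz (symPart_oTangentProj hz _) hYt h
    refine ⟨skewPart Q, symPart_skewPart Q, ?_⟩
    rw [h1, Matrix.mul_zero, Prod.mk_zero_zero, add_zero, sub_eq_iff_eq_add] at h
    rw [h, neg_add_cancel_comm]

theorem oNewtonOp_key (hf : SmoothOnMp p f) (hz : z ∈ SRp m n p) (h : IsLiftedNondegenerate f z)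
    {e : Pair m n p} {x : Pair m n p × Mat p p}
    (hx : oNewtonOp f z x = (fderiv ℝ (oGradLifted f) z e, 0)) :
    x.2 = 0 ∧ dproj z x.1 = dproj z e := by
  have hzR := SRp_subset_Rp hz
  set D := fderiv ℝ (egrad f) z with hD
  have h1 : oConn (oGradLifted f) z x.1 - vert z (skewPart x.2) + (z.1 * symPart x.2, 0)
      = oTangentProj z (D e) := (congrArg Prod.fst hx).trans (fderiv_oGradLifted hf hzR h e)
  have h2 : oConn (oGradLifted f) z x.1 = oTangentProj z (D x.1) := by
    rw [oConn, fderiv_oGradLifted hf hzR h, oTangentProj_of_mem (symPart_oTangentProj hz _)]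
  rw [h2] at h1
  have h3 := symPart_eq_zero_of_tangent_eq hz (symPart_oTangentProj hz _)
    (symPart_oTangentProj hz _) h1
  have h4 : x.2 = skewPart x.2 := by rw [skewPart, h3, sub_zero]
  rw [h3, Matrix.mul_zero, Prod.mk_zero_zero, add_zero, ← h4] at h1
  have h5 : oTangentProj z (D (x.1 - e)) = vert z x.2 := by
    rw [sub_eq_add_neg, ← neg_one_smul ℝ e, map_add, map_smul, oTangentProj_add,
      oTangentProj_smul, ← h1, neg_one_smul]
    abel
  -- Because of the tangential projection, the equation controls the Hessian only against tangent
  -- vectors.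
  have h6 : ∀ t ∈ oTangent z, hessLifted f z (x.1 - e) t = oMetric (vert z x.2) t :=
    fun t ht => by
      rw [← oMetric_fderiv_egrad hf hzR, ← hD, ← h5, oMetric_oTangentProj _ ht]
  have h7 : vert z x.2 = 0 := eq_zero_of_oMetric_self (by
    rw [← h6 _ (vert_mem_oTangent hz h3), h.hess_eq_zero _ _ (dproj_vert _ _)])
  refine ⟨vert_injective hzR h7, ?_⟩
  rw [← sub_eq_zero, ← map_sub]
  refine h.dproj_eq_zero _ fun v => ?_
  -- Subtracting `vert z R` makes an arbitrary `v` tangent, and the Hessian does not see vertical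
  -- vectors, even those that are not tangent to `SRp`. So tangent test vectors suffice.
  set R := symPart (z.1ᵀ * v.1)
  have ht : v - vert z R ∈ oTangent z := by
    rw [mem_oTangent, Prod.fst_sub, vert_apply, Matrix.mul_sub, ← Matrix.mul_assoc, hz.1,
      Matrix.one_mul, symPart_sub, symPart_symPart, sub_self]
  have h8 : hessLifted f z (x.1 - e) v
      = hessLifted f z (x.1 - e) (v - vert z R) + hessLifted f z (x.1 - e) (vert z R) := by
    simp only [← oMetric_fderiv_egrad hf hzR]
    simp only [oMetric, vert_apply, Prod.fst_sub, Prod.snd_sub, Matrix.mul_sub,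
      Matrix.trace_add, Matrix.trace_sub]
    ring
  rw [h8, h6 _ ht, h7, h.hess_eq_zero _ _ (dproj_vert _ _)]
  simp [oMetric]

theorem oNewtonOp_injective (hf : SmoothOnMp p f) (hz : z ∈ SRp m n p)
    (h : IsLiftedNondegenerate f z) {x : Pair m n p × Mat p p} (hx : oNewtonOp f z x = 0) :
    x = 0 := by
  obtain ⟨h1, h2⟩ := oNewtonOp_key hf hz h (e := 0) (x := x) (by rw [hx, map_zero]; rfl)
  rw [map_zero] at h2
  obtain ⟨R, hR⟩ := exists_vert_of_dproj (SRp_subset_Rp hz) h2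
  have h3 : x.1 ∈ oHorizontal z := mem_oHorizontal.2 (congrArg Prod.snd hx)
  -- Among the vectors `vert z R`, tangency to `SRp` leaves those with skew `R`, which are the
  -- vertical vectors of (B).
  have h4 : symPart R = 0 := by
    have := mem_oTangent.1 h3.1
    rwa [hR, vert_apply, ← Matrix.mul_assoc, hz.1, Matrix.one_mul] at this
  have h5 : x.1 = 0 := eq_zero_of_oMetric_self (h3.2 _ (mem_oVertical.2 ⟨R, h4, hR⟩))
  exact Prod.ext h5 h1

theorem newtonStepOrtho_local (hf : SmoothOnMp p f) (hz : z ∈ SRp m n p)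
    (h : IsLiftedNondegenerate f z) :
    ∃ C, ∀ᶠ w in 𝓝 z, w ∈ SRp m n p → ∃ u,
      IsNewtonVector oHorizontal oVertical oConn (oGradLifted f) w u ∧
      (∀ u', IsNewtonVector oHorizontal oVertical oConn (oGradLifted f) w u' → u' = u) ∧
      proj (oExp w u) ∈ Mp m n p ∧ ‖proj (oExp w u) - proj z‖ ≤ C * ‖w - z‖ ^ 2 := by
  have hzR := SRp_subset_Rp hz
  have hE := contDiffAt_oExp (k := ∞) (z, (0 : Pair m n p))
  have hr : HasFDerivAt (fun q : Pair m n p × Pair m n p => proj (oExp q.1 q.2))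
      ((LinearMap.toContinuousLinearMap (dproj z)).comp
        (fderiv ℝ (fun q : Pair m n p × Pair m n p => oExp q.1 q.2) (z, 0))) (z, 0) := by
    have h1 := hasFDerivAt_proj (oExp z 0)
    rw [oExp_zero] at h1
    refine HasFDerivAt.comp (g := proj) (f := fun q : Pair m n p × Pair m n p => oExp q.1 q.2)
      (z, 0) ?_ (hE.differentiableAt (by simp)).hasFDerivAt
    simp only [oExp_zero]
    exact h1
  have := exists_newton_step_bound (z₀ := z) (T := SRp m n p)
    (newton := IsNewtonVector oHorizontal oVertical oConn (oGradLifted f))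
    (retr := fun w u => proj (oExp w u)) (M := Mp m n p) (Y := oGradLifted f) (A := oNewtonOp f)
    (π := dproj z)
    (fun x => (contDiffAt_oNewtonOp hf hzR x).of_le (by norm_cast))
    (fun x => oNewtonOp_injective hf hz h)
    ((contDiffAt_oGradLifted hf hzR).of_le (by norm_cast)) (oGradLifted_eq_zero h)
    (Eventually.of_forall fun w hw => isNewtonVector_ortho_iff hf hw)
    ((contDiffAt_proj _).comp (z, 0) (hE.of_le (by norm_cast)))
    (fun a b => (DFunLike.congr_fun hr.fderiv (a, b)).trans (congrArg (dproj z) (fderiv_oExp z a b)))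
    (by
      have hc : ContinuousAt (fun q : Pair m n p × Pair m n p => oExp q.1 q.2) (z, 0) :=
        hE.continuousAt
      exact (hc.eventually (isOpen_Rp.mem_nhds (by simpa only [oExp_zero] using hzR))).mono
        fun q hq => proj_mem hq)
    (fun e x hx => (oNewtonOp_key hf hz h hx).2)
  simp only [oExp_zero] at this
  exact this

end FixedRank

namespace FixedRank
variable {m n p : ℕ} {f : Mat m n → ℝ} {z : Pair m n p}

/-! ### Invariance under the action of the general linear group -/

theorem act_mem_Rp {R : Mat p p} (hR : IsUnit R.det) (hz : z ∈ Rp m n p) :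
    act R z ∈ Rp m n p := by
  have h : ∀ {a : ℕ} {M : Mat a p} {P : Mat p p} (_ : IsUnit P.det) (_ : M.rank = p),
      (M * P).rank = p := fun {a M P} hP hM => by
    rw [rank_eq_iff_isUnit_gram, Matrix.transpose_mul, Matrix.mul_assoc, ← Matrix.mul_assoc Mᵀ,
      Matrix.det_mul, Matrix.det_mul, Matrix.det_transpose]
    exact hP.mul ((isUnit_gram hM).mul hP)
  exact ⟨h hR hz.1, h (by rw [Matrix.det_transpose]; exact Matrix.isUnit_nonsing_inv_det _ hR) hz.2⟩

theorem fderiv_lifted_act (hf : SmoothOnMp p f) {R : Mat p p} (hR : IsUnit R.det)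
    (hz : z ∈ Rp m n p) (v : Pair m n p) :
    fderiv ℝ (lifted f) (act R z) (act R v) = fderiv ℝ (lifted f) z v :=
  fderiv_apply_of_equivariant (Y := lifted f) (L' := LinearMap.id)
    (Eventually.of_forall fun w => congrArg f (proj_act hR w))
    ((contDiffAt_lifted hf hz).differentiableAt (by simp))
    ((contDiffAt_lifted hf (act_mem_Rp hR hz)).differentiableAt (by simp)) v

/-- The gradient of an invariant function transforms by the transposed inverse of the action, as
read off from the trace pairing. -/
theorem egrad_act (hf : SmoothOnMp p f) {R : Mat p p} (hR : IsUnit R.det) (hz : z ∈ Rp m n p) :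
    egrad f (act R z) = ((egrad f z).1 * R⁻¹ᵀ, (egrad f z).2 * R) := by
  refine oMetric_ext fun v => ?_
  rw [← fderiv_lifted_eq_oMetric]
  conv_lhs => rw [← act_act_inv hR v]
  rw [fderiv_lifted_act hf hR hz, fderiv_lifted_eq_oMetric]
  simp only [oMetric, act_fst, act_snd, Matrix.nonsing_inv_nonsing_inv _ hR, Matrix.trace_add,
    Matrix.transpose_mul, Matrix.transpose_transpose]
  congr 1
  · rw [← Matrix.mul_assoc, Matrix.trace_mul_comm, Matrix.mul_assoc]
  · rw [← Matrix.mul_assoc, Matrix.trace_mul_comm, Matrix.mul_assoc]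

theorem transpose_mul_mul {a : ℕ} (x y : Mat a p) (P : Mat p p) :
    (x * P)ᵀ * (y * P) = Pᵀ * (xᵀ * y) * P := by
  simp only [Matrix.transpose_mul, Matrix.mul_assoc]

theorem symPart_conj (P A : Mat p p) : symPart (Pᵀ * A * P) = Pᵀ * symPart A * P := by
  simp only [symPart, Matrix.transpose_mul, Matrix.transpose_transpose, Matrix.mul_smul,
    Matrix.smul_mul, Matrix.mul_add, Matrix.add_mul, Matrix.mul_assoc]

theorem gram_inv_mul {a : ℕ} (M : Mat a p) (P : Mat p p) :
    ((M * P)ᵀ * (M * P))⁻¹ = P⁻¹ * (Mᵀ * M)⁻¹ * Pᵀ⁻¹ := by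
  rw [transpose_mul_mul, Matrix.mul_inv_rev, Matrix.mul_inv_rev, Matrix.mul_assoc]

theorem connFactor_mul {a : ℕ} (M x y d : Mat a p) {P : Mat p p} (hP : IsUnit P.det) :
    connFactor (M * P) (x * P) (y * P) (d * P) = connFactor M x y d * P := by
  have hPt : IsUnit Pᵀ.det := by rwa [Matrix.det_transpose]
  have h : ∀ (A : Mat a p) (S : Mat p p),
      A * P * (P⁻¹ * (Mᵀ * M)⁻¹ * Pᵀ⁻¹) * (Pᵀ * S * P) = A * (Mᵀ * M)⁻¹ * S * P := fun A S => by
    calc _ = A * (P * P⁻¹) * (Mᵀ * M)⁻¹ * (Pᵀ⁻¹ * Pᵀ) * S * P := by simp only [Matrix.mul_assoc]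
      _ = _ := by rw [Matrix.mul_nonsing_inv _ hP, Matrix.nonsing_inv_mul _ hPt, Matrix.mul_one,
        Matrix.mul_one]
  simp only [connFactor, gram_inv_mul]
  simp only [transpose_mul_mul, symPart_conj, h, Matrix.sub_mul, Matrix.add_mul]

theorem metric_act {R : Mat p p} (hR : IsUnit R.det) (z u v : Pair m n p) :
    metric (act R z) (act R u) (act R v) = metric z u v := by
  have h : ∀ {a : ℕ} (M x y : Mat a p) {P : Mat p p} (_ : IsUnit P.det),
      (((M * P)ᵀ * (M * P))⁻¹ * (x * P)ᵀ * (y * P)).trace = ((Mᵀ * M)⁻¹ * xᵀ * y).trace :=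
    fun {a} M x y {P} hP => by
      have hPt : IsUnit Pᵀ.det := by rwa [Matrix.det_transpose]
      rw [Matrix.mul_assoc, gram_inv_mul, transpose_mul_mul]
      calc _ = (P⁻¹ * ((Mᵀ * M)⁻¹ * (Pᵀ⁻¹ * Pᵀ) * (xᵀ * y)) * P).trace := by
            simp only [Matrix.mul_assoc]
        _ = _ := by rw [Matrix.trace_mul_comm, ← Matrix.mul_assoc, Matrix.mul_nonsing_inv _ hP,
          Matrix.one_mul, Matrix.nonsing_inv_mul _ hPt, Matrix.mul_one, Matrix.mul_assoc]
  have hR' : IsUnit R⁻¹ᵀ.det := by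
    rw [Matrix.det_transpose]; exact Matrix.isUnit_nonsing_inv_det _ hR
  rw [metric, Matrix.trace_add, metric, Matrix.trace_add]
  exact congrArg₂ (· + ·) (h _ _ _ hR) (h _ _ _ hR')

theorem vert_act {R : Mat p p} (hR : IsUnit R.det) (z : Pair m n p) (Q : Mat p p) :
    vert (act R z) Q = act R (vert z (R * Q * R⁻¹)) := by
  have h1 := Matrix.nonsing_inv_mul _ hR
  have h2 : Rᵀ * R⁻¹ᵀ = 1 := by rw [← Matrix.transpose_mul, h1, Matrix.transpose_one]
  simp only [vert_apply]
  refine Prod.ext ?_ ?_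
  · simp only [act_fst, Matrix.mul_assoc, h1, Matrix.mul_one]
  · simp only [act_snd, Matrix.transpose_mul, Matrix.neg_mul, Matrix.mul_assoc, h2, Matrix.mul_one]

theorem act_mem_vertical {R : Mat p p} (hR : IsUnit R.det) {v : Pair m n p} (hv : v ∈ vertical z) :
    act R v ∈ vertical (act R z) := by
  obtain ⟨Q, rfl⟩ := mem_vertical.1 hv
  refine mem_vertical.2 ⟨R⁻¹ * Q * R, ?_⟩
  have h1 : R * (R⁻¹ * Q * R) * R⁻¹ = (R * R⁻¹) * Q * (R * R⁻¹) := by simp only [Matrix.mul_assoc]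
  rw [vert_act hR, h1, Matrix.mul_nonsing_inv _ hR, Matrix.one_mul, Matrix.mul_one]

theorem act_mem_horizontal {R : Mat p p} (hR : IsUnit R.det) {u : Pair m n p}
    (hu : u ∈ horizontal z) : act R u ∈ horizontal (act R z) := fun v hv => by
  obtain ⟨Q, rfl⟩ := mem_vertical.1 hv
  rw [vert_act hR, metric_act hR]
  exact hu _ ⟨_, rfl⟩

theorem gradLifted_act (hf : SmoothOnMp p f) {R : Mat p p} (hR : IsUnit R.det)
    (hz : z ∈ Rp m n p) : gradLifted f (act R z) = act R (gradLifted f z) := by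
  have h := egrad_act hf hR hz
  have h1 : partialM (lifted f) (act R z) = partialM (lifted f) z * R⁻¹ᵀ := congrArg Prod.fst h
  have h2 : partialN (lifted f) (act R z) = partialN (lifted f) z * R := congrArg Prod.snd h
  have h3 : R⁻¹ᵀ * Rᵀ = 1 := by
    rw [← Matrix.transpose_mul, Matrix.mul_nonsing_inv _ hR, Matrix.transpose_one]
  have h4 := Matrix.mul_nonsing_inv _ hR
  refine Prod.ext ?_ ?_
  · simp only [gradLifted, act_fst, h1, transpose_mul_mul]
    calc _ = partialM (lifted f) z * (R⁻¹ᵀ * Rᵀ) * (z.1ᵀ * z.1) * R := by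
          simp only [Matrix.mul_assoc]
      _ = _ := by rw [h3, Matrix.mul_one, Matrix.mul_assoc (partialM _ _)]
  · simp only [gradLifted, act_snd, h2, transpose_mul_mul, Matrix.transpose_transpose]
    calc _ = partialN (lifted f) z * (R * R⁻¹) * (z.2ᵀ * z.2) * R⁻¹ᵀ := by
          simp only [Matrix.mul_assoc]
      _ = _ := by rw [h4, Matrix.mul_one, Matrix.mul_assoc (partialN _ _)]

/-- The derivative of a field that is equivariant and differentiable on the open set
`Rp m n p`. -/
theorem fderiv_act {Y : Pair m n p → Pair m n p} {R : Mat p p} (hR : IsUnit R.det)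
    (hY : ∀ w ∈ Rp m n p, Y (act R w) = act R (Y w))
    (hd : ∀ w ∈ Rp m n p, DifferentiableAt ℝ Y w) (hz : z ∈ Rp m n p) (u : Pair m n p) :
    fderiv ℝ Y (act R z) (act R u) = act R (fderiv ℝ Y z u) :=
  fderiv_apply_of_equivariant
    (by filter_upwards [isOpen_Rp.mem_nhds hz] with w hw using hY w hw)
    (hd _ hz) (hd _ (act_mem_Rp hR hz)) u

/-- Gradient, connection, vertical and horizontal spaces all commute with the action, so existence
and uniqueness at one factorization give them at every other. -/
theorem isNewtonVector_act (hf : SmoothOnMp p f) {R : Mat p p} (hR : IsUnit R.det)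
    (hz : z ∈ Rp m n p) {u : Pair m n p}
    (h : IsNewtonVector horizontal vertical conn (gradLifted f) z u) :
    IsNewtonVector horizontal vertical conn (gradLifted f) (act R z) (act R u) := by
  obtain ⟨h1, h2, h3⟩ := h
  have hY := gradLifted_act hf hR hz
  have hD := fderiv_act hR (fun w hw => gradLifted_act hf hR hw)
    (fun w hw => (contDiffAt_gradLifted hf hw).differentiableAt (by simp)) hz u
  have hR' : IsUnit R⁻¹ᵀ.det := by
    rw [Matrix.det_transpose]; exact Matrix.isUnit_nonsing_inv_det _ hR
  have hC : conn (gradLifted f) (act R z) (act R u) = act R (conn (gradLifted f) z u) := by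
    rw [conn, hD, hY]
    exact Prod.ext (connFactor_mul _ _ _ _ hR) (connFactor_mul _ _ _ _ hR')
  refine ⟨act_mem_horizontal hR h1, ?_, ?_⟩
  · rw [hY, ← map_neg]; exact act_mem_horizontal hR h2
  · rw [hY, ← map_neg, hC, ← map_sub]; exact act_mem_vertical hR h3

/-! ### Invariance under the action of the orthogonal group -/

/-- Reduces the group for (B) to orthogonal matrices, the ones that preserve the Euclidean metric.
-/
theorem orthogonal_of_act_mem {R : Mat p p} (hz : z ∈ SRp m n p) (hz' : act R z ∈ SRp m n p) :
    Rᵀ * R = 1 := by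
  have h := hz'.1
  rwa [act_fst, transpose_mul_mul, hz.1, Matrix.mul_one] at h

theorem act_snd_of_orthogonal {R : Mat p p} (hR : Rᵀ * R = 1) (w : Pair m n p) :
    (act R w).2 = w.2 * R := by
  rw [act_snd, Matrix.inv_eq_left_inv hR, Matrix.transpose_transpose]

theorem oMetric_act {R : Mat p p} (hR : Rᵀ * R = 1) (u v : Pair m n p) :
    oMetric (act R u) (act R v) = oMetric u v := by
  have h : ∀ A : Mat p p, (Rᵀ * A * R).trace = A.trace := fun A => by
    rw [Matrix.trace_mul_comm, ← Matrix.mul_assoc, mul_eq_one_comm.1 hR, Matrix.one_mul]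
  simp only [oMetric, act_fst, act_snd_of_orthogonal hR, transpose_mul_mul, Matrix.trace_add, h]

theorem oTangentProj_act {R : Mat p p} (hR : Rᵀ * R = 1) (z w : Pair m n p) :
    oTangentProj (act R z) (act R w) = act R (oTangentProj z w) := by
  refine Prod.ext ?_ rfl
  simp only [oTangentProj, act_fst, transpose_mul_mul, symPart_conj, Matrix.sub_mul]
  congr 1
  calc _ = z.1 * (R * Rᵀ) * symPart (z.1ᵀ * w.1) * R := by simp only [Matrix.mul_assoc]
    _ = _ := by rw [mul_eq_one_comm.1 hR, Matrix.mul_one]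

theorem act_mem_oVertical {R : Mat p p} (hR : Rᵀ * R = 1) {v : Pair m n p} :
    v ∈ oVertical z → act R v ∈ oVertical (act R z) := by
  rintro ⟨W, hW, rfl⟩
  have h : ∀ {a : ℕ} (A : Mat a p), A * W * R = A * R * (Rᵀ * W * R) := fun A => by
    have h1 : A * R * (Rᵀ * W * R) = A * (R * Rᵀ) * W * R := by simp only [Matrix.mul_assoc]
    rw [h1, mul_eq_one_comm.1 hR, Matrix.mul_one]
  refine ⟨Rᵀ * W * R, ?_, Prod.ext (h _) ?_⟩
  · conv_lhs => rw [hW]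
    simp [Matrix.mul_assoc]
  · rw [act_snd_of_orthogonal hR, act_snd_of_orthogonal hR]
    exact h _

theorem act_mem_oHorizontal {R : Mat p p} (hR : Rᵀ * R = 1) {u : Pair m n p}
    (hu : u ∈ oHorizontal z) : act R u ∈ oHorizontal (act R z) := by
  have hu' : IsUnit R.det := Matrix.isUnit_det_of_left_inverse hR
  have hRi : R⁻¹ᵀ * R⁻¹ = 1 := by
    rw [Matrix.inv_eq_left_inv hR, Matrix.transpose_transpose, mul_eq_one_comm.1 hR]
  refine ⟨mem_oTangent.2 ?_, fun v hv => ?_⟩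
  · rw [act_fst, act_fst, transpose_mul_mul, symPart_conj, mem_oTangent.1 hu.1]
    simp
  · have h1 := act_mem_oVertical hRi hv
    rw [act_inv_act hu'] at h1
    rw [← act_act_inv hu' v, oMetric_act hR]
    exact hu.2 _ h1

theorem oGradLifted_act (hf : SmoothOnMp p f) {R : Mat p p} (hR : Rᵀ * R = 1)
    (hz : z ∈ Rp m n p) : oGradLifted f (act R z) = act R (oGradLifted f z) := by
  have h : egrad f (act R z) = act R (egrad f z) := by
    rw [egrad_act hf (Matrix.isUnit_det_of_left_inverse hR) hz]
    refine Prod.ext ?_ (act_snd_of_orthogonal hR _).symm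
    simp only [act_fst, Matrix.inv_eq_left_inv hR, Matrix.transpose_transpose]
  change oTangentProj (act R z) (egrad f (act R z)) = act R (oTangentProj z (egrad f z))
  rw [h, oTangentProj_act hR]

theorem isNewtonVector_ortho_act (hf : SmoothOnMp p f) {R : Mat p p} (hR : Rᵀ * R = 1)
    (hz : z ∈ Rp m n p) {u : Pair m n p}
    (h : IsNewtonVector oHorizontal oVertical oConn (oGradLifted f) z u) :
    IsNewtonVector oHorizontal oVertical oConn (oGradLifted f) (act R z) (act R u) := by
  obtain ⟨h1, h2, h3⟩ := h
  have hY := oGradLifted_act hf hR hz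
  have hD := fderiv_act (Matrix.isUnit_det_of_left_inverse hR)
    (fun w hw => oGradLifted_act hf hR hw)
    (fun w hw => (contDiffAt_oGradLifted hf hw).differentiableAt (by simp)) hz u
  have hC : oConn (oGradLifted f) (act R z) (act R u) = act R (oConn (oGradLifted f) z u) := by
    rw [oConn, hD, oTangentProj_act hR]
    rfl
  refine ⟨act_mem_oHorizontal hR h1, ?_, ?_⟩
  · rw [hY, ← map_neg]; exact act_mem_oHorizontal hR h2
  · rw [hY, ← map_neg, hC, ← map_sub]; exact act_mem_oVertical hR h3

theorem oExp_act {R : Mat p p} (hR : Rᵀ * R = 1) (z u : Pair m n p) :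
    oExp (act R z) (act R u) = act R (oExp z u) := by
  have hR' := mul_eq_one_comm.1 hR
  have conj : ∀ A : Mat p p, R * (Rᵀ * A * R) = A * R := fun A => by
    rw [← Matrix.mul_assoc, ← Matrix.mul_assoc, hR', Matrix.one_mul]
  -- `diag(R, R)` intertwines the block matrices at the two factorizations, as `R` does the matrices
  -- `A`; the factors `R` then travel to the right end of the product.
  let D : Matrix (Fin p ⊕ Fin p) (Fin p ⊕ Fin p) ℝ := Matrix.fromBlocks R 0 0 R
  have h1 : Matrix.fromCols (z.1 * R) (u.1 * R) = Matrix.fromCols z.1 u.1 * D := by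
    simp [D, Matrix.fromCols_mul_fromBlocks]
  let I : Matrix (Fin p ⊕ Fin p) (Fin p) ℝ := Matrix.fromRows (1 : Mat p p) (0 : Mat p p)
  have h2 : D * I = I * R := by
    simp [D, I, Matrix.fromBlocks_mul_fromRows, Matrix.fromRows_mul]
  have key : ∀ (c : Matrix (Fin m) (Fin p ⊕ Fin p) ℝ) {X X' : Matrix (Fin p ⊕ Fin p) (Fin p ⊕ Fin p) ℝ}
      {Y Y' : Mat p p}, D * X' = X * D → R * Y' = Y * R →
      c * D * X' * I * Y' = c * X * I * Y * R := fun c {X X' Y Y'} hX hY => by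
    rw [Matrix.mul_assoc c D, hX, ← Matrix.mul_assoc, Matrix.mul_assoc _ D, h2,
      ← Matrix.mul_assoc, Matrix.mul_assoc _ R, hY, ← Matrix.mul_assoc]
  have h3 := Matrix.mul_exp_of_mul_eq (D := D)
    (B := Matrix.fromBlocks (Rᵀ * (z.1ᵀ * u.1) * R) (-(Rᵀ * (u.1ᵀ * u.1) * R)) (1 : Mat p p)
      (Rᵀ * (z.1ᵀ * u.1) * R))
    (B' := Matrix.fromBlocks (z.1ᵀ * u.1) (-(u.1ᵀ * u.1)) (1 : Mat p p) (z.1ᵀ * u.1)) (by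
      simp [D, Matrix.fromBlocks_multiply, conj])
  have h4 := Matrix.mul_exp_of_mul_eq (D := R) (B := -(Rᵀ * (z.1ᵀ * u.1) * R))
    (B' := -(z.1ᵀ * u.1)) (by rw [Matrix.mul_neg, conj, Matrix.neg_mul])
  refine Prod.ext ?_ ?_
  · simp only [oExp, act_fst, transpose_mul_mul]
    rw [h1]
    exact key _ h3 h4
  · simp only [oExp, act_snd, Matrix.add_mul]

/-! ### Convergence -/

/-- A local step bound at one point of the fibre, together with invariance along the fibres,
implies local quadratic convergence. -/
theorem locallyQuadraticallyConvergent_of_step {T : Set (Pair m n p)}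
    {newton : Pair m n p → Pair m n p → Prop} {retr : Pair m n p → Pair m n p → Mat m n}
    (hT : SRp m n p ⊆ T) (hT' : T ⊆ Rp m n p) (hz : z ∈ SRp m n p)
    (hact : ∀ w ∈ T, ∀ R : Mat p p, IsUnit R.det → act R w ∈ T → ∀ u, newton w u →
      newton (act R w) (act R u) ∧ retr (act R w) (act R u) = retr w u)
    (hstep : ∃ C, ∀ᶠ w in 𝓝 z, w ∈ T → ∃ u, newton w u ∧ (∀ u', newton w u' → u' = u) ∧
      retr w u ∈ Mp m n p ∧ ‖retr w u - proj z‖ ≤ C * ‖w - z‖ ^ 2) :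
    LocallyQuadraticallyConvergent p (IsStep T newton retr) (proj z) := by
  obtain ⟨C, hC⟩ := hstep
  -- A section with values in `SRp` serves both iterations, since `SRp ⊆ T`.
  obtain ⟨c, hc⟩ := exists_local_section hz
  obtain ⟨r, hr, hball⟩ := Metric.eventually_nhds_iff_ball.1 hC
  have hsmall : ∀ᶠ X in 𝓝 (proj z), c * ‖X - proj z‖ < r := by
    have h1 : ContinuousAt (fun X : Mat m n => c * ‖X - proj z‖) (proj z) := by fun_prop
    exact h1.eventually (gt_mem_nhds (by simpa using hr))
  refine locallyQuadraticallyConvergent_of_bound (C := |C| * c ^ 2) ?_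
  filter_upwards [hc, hsmall] with X h1 h2 hX
  obtain ⟨w, hw, rfl, hwz⟩ := h1 hX
  have hwT := hT hw
  obtain ⟨u, hu, huniq, hmem, hbd⟩ := hball w (by
    rw [Metric.mem_ball, dist_eq_norm]; exact hwz.trans_lt h2) hwT
  refine ⟨retr w u, hmem, ⟨⟨w, hwT, rfl⟩, hmem, fun w' hw' hproj => ?_⟩, ?_⟩
  · obtain ⟨R, hR, rfl⟩ := exists_act_eq (hT' hwT) (hT' hw') hproj.symm
    obtain ⟨h3, h4⟩ := hact w hwT R hR hw' u hu
    refine ⟨act R u, h3, fun u' hu' => ?_, h4⟩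
    -- Any competing solution at `w'` is carried back by `R⁻¹` to `w`, where uniqueness is known.
    have h5 := (hact _ hw' R⁻¹ (Matrix.isUnit_nonsing_inv_det _ hR)
      (by rwa [act_inv_act hR]) u' hu').1
    rw [act_inv_act hR] at h5
    rw [← huniq _ h5, act_act_inv hR]
  · calc _ ≤ C * ‖w - z‖ ^ 2 := hbd
      _ ≤ |C| * ‖w - z‖ ^ 2 := by gcongr; exact le_abs_self C
      _ ≤ |C| * (c * ‖proj w - proj z‖) ^ 2 := by gcongr
      _ = _ := by ring

end FixedRank

theorem mainTheorem2 (m n p : ℕ) (hp : 0 < p) (hpm : p ≤ m) (hpn : p ≤ n)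
    (f : FixedRank.Mat m n → ℝ) (hf : FixedRank.SmoothOnMp p f)
    (g : FixedRank.Mat m n → FixedRank.Mat m n → FixedRank.Mat m n → ℝ)
    (hg : FixedRank.IsRiemannianMetric p g)
    (Xs : FixedRank.Mat m n) (hXs : FixedRank.IsNondegenerateCriticalPoint p g f Xs) :
    FixedRank.LocallyQuadraticallyConvergent p (FixedRank.NewtonStep p f) Xs ∧
      FixedRank.LocallyQuadraticallyConvergent p (FixedRank.NewtonStepOrtho p f) Xs := by
  -- An orthonormal base point lies in both total spaces.
  obtain ⟨z, hz, rfl⟩ := FixedRank.exists_mem_SRp hXs.1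
  have hzR := FixedRank.SRp_subset_Rp hz
  have h := FixedRank.IsNondegenerateCriticalPoint.lifted hf hg hzR hXs
  refine ⟨FixedRank.locallyQuadraticallyConvergent_of_step FixedRank.SRp_subset_Rp subset_rfl hz
      (fun w hw R hR _ u hu => ⟨FixedRank.isNewtonVector_act hf hR hw hu, ?_⟩)
      (FixedRank.newtonStep_local hf hzR h),
    FixedRank.locallyQuadraticallyConvergent_of_step subset_rfl FixedRank.SRp_subset_Rp hz
      (fun w hw R hR hw' u hu => ?_) (FixedRank.newtonStepOrtho_local hf hz h)⟩
  · rw [← map_add]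
    exact FixedRank.proj_act hR _
  · have hO := FixedRank.orthogonal_of_act_mem hw hw'
    refine ⟨FixedRank.isNewtonVector_ortho_act hf hO (FixedRank.SRp_subset_Rp hw) hu, ?_⟩
    rw [FixedRank.oExp_act hO]
    exact FixedRank.proj_act hR _
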